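/- Let $\mathcal D=(0,1)$, write $\|\cdot\|$ and $(\cdot,\cdot)$ for the norm and inner product of $L^2(\mathcal D)$, and let $\gamma>0$ be the best constant in the Poincaré inequality $\|v'\|^2\ge\gamma\|v\|^2$, $v\in H^1_0(\mathcal D)$. Let $W=\{W(x):x\in[0,1]\}$ be a fractional Brownian motion with Hurst index $H\in(0,1/2]$ on a probability space $(\Omega,\mathscr F,\mathbb P)$, i.e. a centred Gaussian process with $\mathbb E[W(x)W(y)]=\frac12\left(x^{2H}+y^{2H}-|x-y|^{2H}\right)$. Integrals $\int_{\mathcal D}\phi\,dW$ of deterministic functions are Wiener integrals: the elementary integral $\sum_j f_j\,(W(a_{j+1})-W(a_j))$ of step functions $\sum_j f_j\chi_{(a_j,a_{j+1}]}$, extended by completion in $L^2(\mathbb P)$. Let $g\in L^2(\mathcal D)$ and let $f:\mathcal D\times\mathbb R\to\mathbb R$ be measurable with $f(\cdot,0)\in L^2(\mathcal D)$ (for instance $f(\cdot,0)=0$), such that for some constants $0<L<\gamma$ and $\beta>0$, for all $x\in\mathcal D$ and $r,s\in\mathbb R$, $$(f(x,r)-f(x,s))(r-s)\ge -L|r-s|^2,\qquad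 |f(x,r)-f(x,s)|\le\beta(1+|r-s|).$$ Let $u$ be a mild solution of $-u''+f(x,u)=g+\dot W$ in $\mathcal D$, $u=0$ on $\partial\mathcal D$: a measurable process with sample paths in $L^2(\mathcal D)$ a.s. such that, with $G(x,y)=x\wedge y-xy$, for every $x\in\mathcal D$, almost surely $$u(x)+\int_{\mathcal D}G(x,y)f(y,u(y))\,dy=\int_{\mathcal D}G(x,y)g(y)\,dy+\int_{\mathcal D}G(x,y)\,dW(y).$$ For $n\ge1$ let $h=1/n$ and let $$\dot W^n(x)=\sum_{i=0}^{n-1}\frac{W((i+1)h)-W(ih)}{h}\,\chi_{(ih,(i+1)h]}(x)$$ be the piecewise constant approximation of the noise. Let $u^n$ be a variational solution of $-(u^n)''+f(x,u^n)=g+\dot W^n$ in $\mathcal D$, $u^n=0$ on $\partial\mathcal D$: a measurable process such that almost surely $u^n\in H^1_0(\mathcal D)$ and $((u^n)',v')+(f(\cdot,u^n),v)=(g+\dot W^n,v)$ for all $v\in H^1_0(\mathcal D)$. Then there is a constant $C>0$, independent of $n$, such that for all $n\ge 1$ $$\sqrt{\mathbb E\left[\|u-u^n\|^2\right]}\le C\,h^{\frac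 H2+\frac14}.$$ If, furthermore, $f$ is Lipschitz continuous in its second variable with constant $L<\gamma$, i.e. $|f(x,r)-f(x,s)|\le L|r-s|$ for all $x\in\mathcal D$ and $r,s\in\mathbb R$, then there is a constant $C>0$, independent of $n$, such that for all $n\ge 1$ $$\sqrt{\mathbb E\left[\|u-u^n\|^2\right]}\le C\,h^{H+\frac12}.$$ -/

import Mathlib

open MeasureTheory ProbabilityTheory Set Filter Topology
open scoped ENNReal

noncomputable section

namespace FracBVP

/-- Lebesgue measure on the domain `(0, 1)`. -/
def volD : Measure ℝ := volume.restrict (Ioo (0 : ℝ) 1)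

/-- `v ∈ H¹₀(0, 1)` with weak derivative `w`: in dimension one, `v` is (on `[0, 1]`) the primitive
of the square integrable function `w`, and `v` vanishes at both end points. -/
structure IsH10 (v w : ℝ → ℝ) : Prop where
  memLp : MemLp w 2 volD
  eq_primitive : ∀ x ∈ Icc (0 : ℝ) 1, v x = ∫ t in (0 : ℝ)..x, w t
  right : v 1 = 0

/-- The constant `γ` of the Poincaré inequality `‖v'‖² ≥ γ ‖v‖²` on `H¹₀(0, 1)`: the supremum
of all admissible constants. -/
def poincareConst : ℝ :=
  sSup {c : ℝ | ∀ v w : ℝ → ℝ, IsH10 v w → c * ∫ x, v x ^ 2 ∂volD ≤ ∫ x, w x ^ 2 ∂volD}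

lemma integral_volD (F : ℝ → ℝ) : ∫ x, F x ∂volD = ∫ x in (0:ℝ)..1, F x := by
  rw [intervalIntegral.integral_of_le zero_le_one, integral_Ioc_eq_integral_Ioo, volD]

lemma IsH10.sq_le {v w : ℝ → ℝ} (h : IsH10 v w) {x : ℝ} (hx : x ∈ Icc (0 : ℝ) 1) :
    v x ^ 2 ≤ x * ∫ t, w t ^ 2 ∂volD := by
  have hfin : IsFiniteMeasure volD := by unfold volD; infer_instance
  have h2 : IntervalIntegrable (fun t => w t ^ 2) volume 0 1 := by
    rw [intervalIntegrable_iff_integrableOn_Ioo_of_le zero_le_one]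
    exact h.memLp.integrable_sq
  have h1 : IntervalIntegrable w volume 0 1 := by
    rw [intervalIntegrable_iff_integrableOn_Ioo_of_le zero_le_one]
    exact h.memLp.integrable (by norm_num)
  have hs : uIcc 0 x ⊆ uIcc (0 : ℝ) 1 := by
    rw [uIcc_of_le hx.1, uIcc_of_le zero_le_one]; exact Icc_subset_Icc le_rfl hx.2
  have hs' : uIcc x 1 ⊆ uIcc (0 : ℝ) 1 := by
    rw [uIcc_of_le hx.2, uIcc_of_le zero_le_one]; exact Icc_subset_Icc hx.1 le_rfl
  have hmono : ∫ t in (0 : ℝ)..x, w t ^ 2 ≤ ∫ t, w t ^ 2 ∂volD := by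
    rw [integral_volD, ← intervalIntegral.integral_add_adjacent_intervals (h2.mono_set hs)
      (h2.mono_set hs')]
    have := intervalIntegral.integral_nonneg (μ := volume) hx.2 (fun t _ => sq_nonneg (w t))
    linarith
  have hquad : ∀ c : ℝ, 0 ≤ (∫ t in (0 : ℝ)..x, w t ^ 2) - 2 * c * v x + c ^ 2 * x := by
    intro c
    have := intervalIntegral.integral_nonneg (μ := volume) hx.1 (fun t _ => sq_nonneg (w t - c))
    have e : (fun t => (w t - c) ^ 2) = fun t => (w t ^ 2 - 2 * c * w t) + c ^ 2 := by
      ext t; ring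
    rw [e, intervalIntegral.integral_add ((h2.mono_set hs).sub ((h1.mono_set hs).const_mul _))
      (by simp), intervalIntegral.integral_sub (h2.mono_set hs) ((h1.mono_set hs).const_mul _),
      intervalIntegral.integral_const_mul, ← h.eq_primitive x hx] at this
    simp only [intervalIntegral.integral_const, smul_eq_mul, sub_zero] at this
    linarith
  rcases hx.1.eq_or_lt with h0 | h0
  · have : v x = 0 := by rw [h.eq_primitive x hx, ← h0]; simp
    rw [this, ← h0]; simp
  · have := hquad (v x / x)
    have e : (∫ t in (0 : ℝ)..x, w t ^ 2) - 2 * (v x / x) * v x + (v x / x) ^ 2 * x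
        = (∫ t in (0 : ℝ)..x, w t ^ 2) - v x ^ 2 / x := by field_simp; ring
    rw [e] at this
    have h3 : v x ^ 2 / x ≤ ∫ t, w t ^ 2 ∂volD := by linarith
    rw [div_le_iff₀ h0] at h3
    linarith

/-- The set of admissible Poincaré constants is bounded. -/
lemma poincare_bddAbove : BddAbove {c : ℝ | ∀ v w : ℝ → ℝ, IsH10 v w →
    c * ∫ x, v x ^ 2 ∂volD ≤ ∫ x, w x ^ 2 ∂volD} := by
  refine ⟨10, fun c hc => ?_⟩
  have hfin : IsFiniteMeasure volD := by unfold volD; infer_instance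
  have hI : IsH10 (fun x => x - x ^ 2) (fun x => 1 - 2 * x) := by
    refine ⟨?_, fun x _ => ?_, by norm_num⟩
    · refine MemLp.of_bound (C := 1) (by fun_prop) ?_
      refine (ae_restrict_iff' measurableSet_Ioo).2 (Eventually.of_forall fun x hx => ?_)
      rw [Real.norm_eq_abs, abs_le]; constructor <;> linarith [hx.1, hx.2]
    · rw [intervalIntegral.integral_sub (by simp) (Continuous.intervalIntegrable (by fun_prop) _ _)]
      rw [intervalIntegral.integral_const_mul, integral_id, intervalIntegral.integral_const,
        smul_eq_mul]
      ring
  have h := hc _ _ hI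
  rw [integral_volD, integral_volD] at h
  have e1 : ∫ x in (0:ℝ)..1, (x - x ^ 2) ^ 2 = 1 / 30 := by
    have : (fun x : ℝ => (x - x ^ 2) ^ 2) = fun x => (x ^ 2 - 2 * x ^ 3) + x ^ 4 := by ext; ring
    rw [this, intervalIntegral.integral_add (Continuous.intervalIntegrable (by fun_prop) _ _)
      (Continuous.intervalIntegrable (by fun_prop) _ _), intervalIntegral.integral_sub
      (Continuous.intervalIntegrable (by fun_prop) _ _)
      (Continuous.intervalIntegrable (by fun_prop) _ _), intervalIntegral.integral_const_mul]
    simp only [integral_pow]; norm_num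
  have e2 : ∫ x in (0:ℝ)..1, (1 - 2 * x) ^ 2 = 1 / 3 := by
    have : (fun x : ℝ => (1 - 2 * x) ^ 2) = fun x => (4 * x ^ 2 - 4 * x ^ 1) + x ^ 0 := by
      ext; ring
    rw [this, intervalIntegral.integral_add (Continuous.intervalIntegrable (by fun_prop) _ _)
      (Continuous.intervalIntegrable (by fun_prop) _ _), intervalIntegral.integral_sub
      (Continuous.intervalIntegrable (by fun_prop) _ _)
      (Continuous.intervalIntegrable (by fun_prop) _ _), intervalIntegral.integral_const_mul,
      intervalIntegral.integral_const_mul]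
    simp only [integral_pow]; norm_num
  rw [e1, e2] at h
  linarith

/-- `2` is an admissible Poincaré constant, so the condition `L < γ` covers all `L < 2`. -/
lemma two_le_poincareConst : 2 ≤ poincareConst := by
  refine le_csSup poincare_bddAbove fun v w h => ?_
  set A := ∫ x, w x ^ 2 ∂volD with hA
  have hI : ∫ x, v x ^ 2 ∂volD ≤ ∫ x, x * A ∂volD := by
    refine integral_mono_of_nonneg (Eventually.of_forall fun x => sq_nonneg _) ?_ ?_
    · have : IntervalIntegrable (fun x : ℝ => x * A) volume 0 1 :=
        Continuous.intervalIntegrable (by fun_prop) _ _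
      rwa [intervalIntegrable_iff_integrableOn_Ioo_of_le zero_le_one] at this
    · exact (ae_restrict_iff' measurableSet_Ioo).2
        (Eventually.of_forall fun x hx => h.sq_le (Ioo_subset_Icc_self hx))
  rw [integral_volD (fun x => x * A), intervalIntegral.integral_mul_const, integral_id] at hI
  linarith

/-- A fractional Brownian motion on `[0, 1]` with Hurst index `H`: a centred Gaussian process
with the covariance `(x^{2H} + y^{2H} - |x - y|^{2H}) / 2`. Only the values `W x`,
`x ∈ [0, 1]`, are meaningful. -/
structure IsFBM {Ω : Type*} [MeasurableSpace Ω] (P : Measure Ω) (H : ℝ) (W : ℝ → Ω → ℝ) :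
    Prop where
  gaussian : IsGaussianProcess (fun x : Icc (0 : ℝ) 1 => W x) P
  centred : ∀ x ∈ Icc (0 : ℝ) 1, ∫ ω, W x ω ∂P = 0
  cov : ∀ x ∈ Icc (0 : ℝ) 1, ∀ y ∈ Icc (0 : ℝ) 1,
    ∫ ω, W x ω * W y ω ∂P = (x ^ (2 * H) + y ^ (2 * H) - |x - y| ^ (2 * H)) / 2

/-- A step function `∑_{j < N} f_j χ_{(a_j, a_{j+1}]}` with `0 = a_0 < a_1 < ⋯ < a_N = 1`.
Only `a_0, …, a_N` and `f_0, …, f_{N-1}` are meaningful. -/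
structure StepFn where
  N : ℕ
  a : ℕ → ℝ
  coeff : ℕ → ℝ
  a_zero : a 0 = 0
  a_last : a N = 1
  a_lt : ∀ j < N, a j < a (j + 1)

/-- The step function as a function on the line. -/
def StepFn.toFun (s : StepFn) (x : ℝ) : ℝ :=
  ∑ j ∈ Finset.range s.N, (Ioc (s.a j) (s.a (j + 1))).indicator (fun _ => s.coeff j) x

/-- The elementary integral `I(s) = ∑_j f_j (W(a_{j+1}) - W(a_j))`. -/
def StepFn.integral {Ω : Type*} (W : ℝ → Ω → ℝ) (s : StepFn) (ω : Ω) : ℝ :=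
  ∑ j ∈ Finset.range s.N, s.coeff j * (W (s.a (j + 1)) ω - W (s.a j) ω)

/-- `X = ∫_D φ dW`: the integral is the extension of the elementary integral to the completion of
the step functions under `E[I(f) I(g)]`, realised as a space of functions in `L²(0, 1)`. Thus there
are step functions `s_k → φ` in `L²(0, 1)` with `I(s_k) → X` in `L²(P)`. -/
def IsWienerIntegral {Ω : Type*} [MeasurableSpace Ω] (P : Measure Ω) (W : ℝ → Ω → ℝ)
    (φ : ℝ → ℝ) (X : Ω → ℝ) : Prop :=
  MemLp φ 2 volD ∧ MemLp X 2 P ∧ ∃ s : ℕ → StepFn,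
    Tendsto (fun k => eLpNorm (fun x => (s k).toFun x - φ x) 2 volD) atTop (𝓝 0) ∧
    Tendsto (fun k => eLpNorm (fun ω => (s k).integral W ω - X ω) 2 P) atTop (𝓝 0)

/-- The Green's function of `-d²/dx²` on `(0, 1)` with homogeneous Dirichlet conditions. -/
def green (x y : ℝ) : ℝ := min x y - x * y

/-- The conditions on the nonlinearity `f : (0, 1) × ℝ → ℝ`: monotonicity up to `L`,
linear growth with constant `β`, and square integrability of `f(·, 0)`
(which is automatic under the normalisation `f(·, 0) = 0`). -/
structure IsAdmissible (L β : ℝ) (f : ℝ → ℝ → ℝ) : Prop where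
  measurable : Measurable (Function.uncurry f)
  zero_memLp : MemLp (fun x => f x 0) 2 volD
  L_pos : 0 < L
  L_lt : L < poincareConst
  monotone : ∀ x ∈ Ioo (0 : ℝ) 1, ∀ r s : ℝ, -L * |r - s| ^ 2 ≤ (f x r - f x s) * (r - s)
  β_pos : 0 < β
  growth : ∀ x ∈ Ioo (0 : ℝ) 1, ∀ r s : ℝ, |f x r - f x s| ≤ β * (1 + |r - s|)

/-- `u` is a mild solution of `-u'' + f(x, u) = g + Ẇ`, `u(0) = u(1) = 0`. -/
structure IsMildSolution {Ω : Type*} [MeasurableSpace Ω] (P : Measure Ω) (W : ℝ → Ω → ℝ)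
    (f : ℝ → ℝ → ℝ) (g : ℝ → ℝ) (u : ℝ → Ω → ℝ) : Prop where
  aemeasurable : AEMeasurable (Function.uncurry u) (volD.prod P)
  memLp : ∀ᵐ ω ∂P, MemLp (fun x => u x ω) 2 volD
  mild : ∀ x ∈ Ioo (0 : ℝ) 1, ∃ X : Ω → ℝ, IsWienerIntegral P W (green x) X ∧
    ∀ᵐ ω ∂P, u x ω + ∫ y, green x y * f y (u y ω) ∂volD
      = ∫ y, green x y * g y ∂volD + X ω

/-- The piecewise constant approximation `Ẇⁿ` of the noise on the uniform grid with mesh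
`h = 1 / n`; on the cell `(i h, (i + 1) h]` it is `h⁻¹ (W((i + 1) h) - W(i h))`. -/
def noiseApprox {Ω : Type*} (W : ℝ → Ω → ℝ) (n : ℕ) (x : ℝ) (ω : Ω) : ℝ :=
  ∑ i ∈ Finset.range n,
    (Ioc ((i : ℝ) / n) (((i : ℝ) + 1) / n)).indicator
      (fun _ => (n : ℝ) * (W (((i : ℝ) + 1) / n) ω - W ((i : ℝ) / n) ω)) x

/-- `un` solves `-(uⁿ)'' + f(x, uⁿ) = g + Ẇⁿ`, `uⁿ(0) = uⁿ(1) = 0`, in the variational sense: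
almost surely `uⁿ ∈ H¹₀(0, 1)` and
`((uⁿ)', v') + (f(uⁿ), v) = (g + Ẇⁿ, v)` for all `v ∈ H¹₀(0, 1)`. -/
structure IsApproxSolution {Ω : Type*} [MeasurableSpace Ω] (P : Measure Ω) (W : ℝ → Ω → ℝ)
    (f : ℝ → ℝ → ℝ) (g : ℝ → ℝ) (n : ℕ) (un : ℝ → Ω → ℝ) : Prop where
  aemeasurable : AEMeasurable (Function.uncurry un) (volD.prod P)
  variational : ∀ᵐ ω ∂P, ∃ w : ℝ → ℝ, IsH10 (fun x => un x ω) w ∧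
    ∀ v v' : ℝ → ℝ, IsH10 v v' →
      ∫ x, w x * v' x ∂volD + ∫ x, f x (un x ω) * v x ∂volD
        = ∫ x, (g x + noiseApprox W n x ω) * v x ∂volD

/-- The mean-square error `√(E ‖u - v‖²)`, with the norm of `L²(0, 1)`, as an extended
nonnegative number (so that a finite bound contains square integrability). -/
def msError {Ω : Type*} [MeasurableSpace Ω] (P : Measure Ω) (u v : ℝ → Ω → ℝ) : ℝ≥0∞ :=
  (∫⁻ ω, (eLpNorm (fun x => u x ω - v x ω) 2 volD) ^ 2 ∂P) ^ (1 / 2 : ℝ)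

end FracBVP

end

namespace FracBVP

/-! The proof combines a mean-square bound for the noise error with a pathwise stability estimate.

Noise. For `H ≤ 1/2` the variance of `∫ φ dW` is a Dirichlet form: the double integral of `H(1-2H)/2
|y-z|^(2H-2) (φ y - φ z)²` plus a boundary term with weight `H (y^(2H-1) + (1-y)^(2H-1))` against
`φ²`. Placing the boundary term on the points `(y, 0)` turns it into a single `L²` norm of `φ y - φ
z` under `energyMeasure`. The identity is checked on intervals
(`lintegral_indicator_energyMeasure`), polarised, and extended by linearity to step functions
(`eLpNorm_integral_sub`). Fatou's lemma extends the upper bound to Wiener integrals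
(`IsWienerIntegral.eLpNorm_sub_le`). Pairing the approximate noise with `φ` is the elementary
integral of the cell averages of `φ`. The noise error at `x` is therefore bounded by the energy
distance of the Lipschitz function `green x` to its cell averages, whose square is at most `5
h^(2H+1)` (`eLpNorm_sub_cellAverage_sq_le`).

Stability. Let `e = u - uⁿ`, `F = f(u) - f(uⁿ)`, `v = greenOp F`. Subtracting the two integral
equations shows that `E = e + v` is exactly the noise error. Moreover `(F, v) = ‖v'‖² ≥ (L + κ)‖v‖²`
for some `κ > 0`, because `L` lies strictly below the Poincaré constant. A pointwise bound `F v ≤ (L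
+ κ/2) v² + a E² + b` then controls `‖v‖`, hence `‖e‖`, by `‖E‖` and `b`
(`integral_sq_le_of_energy`). In the Lipschitz case `b = 0` and the full rate survives. In the
monotone case the bounded jumps allowed by the growth condition leave a term `β |E| ≤ β δ + (β/δ)
E²`; the choice `δ = h^(H+1/2)` balances the two contributions and gives half the rate. -/

instance : IsFiniteMeasure volD := by unfold volD; infer_instance

/-! ### The fractional energy measure and the energy of intervals -/

/-- The density `H (1 - 2H) / 2 * |y - z| ^ (2H - 2)` of the jump part of the fractional energy. -/
noncomputable def jumpKernel (H y z : ℝ) : ℝ≥0∞ :=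
  ENNReal.ofReal (H * (1 - 2 * H) / 2 * |y - z| ^ (2 * H - 2))

/-- The density of the boundary part of the fractional energy. -/
noncomputable def killingWeight (H y : ℝ) : ℝ≥0∞ :=
  ENNReal.ofReal (H * (y ^ (2 * H - 1) + (1 - y) ^ (2 * H - 1)))

/-- The measure on pairs of points for which `∫ (φ y - φ z)² d(energyMeasure H)(y, z)` is the
variance of the Wiener integral of `φ`, for `φ` with `φ 0 = 0`. -/
noncomputable def energyMeasure (H : ℝ) : Measure (ℝ × ℝ) :=
  (volD.prod volD).withDensity (fun p => jumpKernel H p.1 p.2) +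
    (volD.withDensity (killingWeight H)).map (fun y => (y, 0))

lemma measurable_jumpKernel (H : ℝ) : Measurable (fun p : ℝ × ℝ => jumpKernel H p.1 p.2) := by
  unfold jumpKernel; fun_prop

lemma measurable_killingWeight (H : ℝ) : Measurable (killingWeight H) := by
  unfold killingWeight; fun_prop

lemma jumpKernel_comm (H y z : ℝ) : jumpKernel H y z = jumpKernel H z y := by
  unfold jumpKernel; rw [abs_sub_comm]

lemma lintegral_energyMeasure (H : ℝ) {F : ℝ × ℝ → ℝ≥0∞} (hF : Measurable F) :
    ∫⁻ p, F p ∂energyMeasure H =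
      (∫⁻ y, ∫⁻ z, jumpKernel H y z * F (y, z) ∂volD ∂volD) +
        ∫⁻ y, killingWeight H y * F (y, 0) ∂volD := by
  unfold energyMeasure
  have hk := measurable_jumpKernel H
  have hm : Measurable (fun y : ℝ => (y, (0 : ℝ))) := by fun_prop
  rw [lintegral_add_measure, lintegral_withDensity_eq_lintegral_mul _ hk hF,
    lintegral_prod _ (hk.mul hF).aemeasurable, lintegral_map hF hm]
  exact congrArg₂ _ rfl
    (lintegral_withDensity_eq_lintegral_mul _ (measurable_killingWeight H) (hF.comp hm))

/-- The kernel has the explicit antiderivative `H (y - z)^(2H-1) / 2` in `z`. The factor 2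
anticipates that the energy counts each pair of points in both orders. -/
lemma lintegral_left_jumpKernel {H : ℝ} (hH0 : 0 < H) (hH : H ≤ 1 / 2) {a y : ℝ} (ha : 0 ≤ a)
    (hy : a < y) : 2 * ∫⁻ z in Ioc 0 a, jumpKernel H y z =
      ENNReal.ofReal (H * ((y - a) ^ (2 * H - 1) - y ^ (2 * H - 1))) := by
  have e : ∀ z ∈ Ioc 0 a, jumpKernel H y z =
      ENNReal.ofReal (1 / 2) * ENNReal.ofReal (H * ((1 - 2 * H) * (y - z) ^ (2 * H - 2))) := by
    intro z hz
    rw [jumpKernel, ← ENNReal.ofReal_mul (by norm_num), abs_of_pos (by linarith [hz.2])]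
    congr 1; ring
  have hd : ∀ z ∈ uIcc 0 a, HasDerivAt (fun z => H * (y - z) ^ (2 * H - 1))
      (H * ((1 - 2 * H) * (y - z) ^ (2 * H - 2))) z := by
    intro z hz
    rw [uIcc_of_le ha] at hz
    have h1 : HasDerivAt (fun z : ℝ => y - z) (-1) z := by
      simpa using (hasDerivAt_id z).const_sub y
    have := (h1.rpow_const (p := 2 * H - 1) (Or.inl (by linarith [hz.2]))).const_mul H
    refine this.congr_deriv ?_
    rw [show 2 * H - 1 - 1 = 2 * H - 2 by ring]; ring
  have hc : ContinuousOn (fun z => H * ((1 - 2 * H) * (y - z) ^ (2 * H - 2))) (uIcc 0 a) := by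
    refine continuousOn_const.mul (continuousOn_const.mul ?_)
    refine ContinuousOn.rpow_const (by fun_prop) fun z hz => Or.inl ?_
    rw [uIcc_of_le ha] at hz
    linarith [hz.2]
  have hi := hc.intervalIntegrable (μ := volume)
  have hI := intervalIntegral.integral_eq_sub_of_hasDerivAt hd hi
  rw [setLIntegral_congr_fun measurableSet_Ioc e, lintegral_const_mul' _ _ ENNReal.ofReal_ne_top,
    ← ofReal_integral_eq_lintegral_ofReal, ← intervalIntegral.integral_of_le ha, hI, ← mul_assoc,
    ← ENNReal.ofReal_ofNat 2, ← ENNReal.ofReal_mul (by norm_num)]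
  · norm_num
    ring_nf
  · exact (intervalIntegrable_iff_integrableOn_Ioc_of_le ha).1 hi
  · refine (ae_restrict_iff' measurableSet_Ioc).2 (Eventually.of_forall fun z hz => ?_)
    have := Real.rpow_nonneg (show 0 ≤ y - z by linarith [hz.2]) (2 * H - 2)
    have : 0 ≤ 1 - 2 * H := by linarith
    positivity

lemma lintegral_right_jumpKernel {H : ℝ} (hH0 : 0 < H) (hH : H ≤ 1 / 2) {b y : ℝ} (hb : b ≤ 1)
    (hy : y < b) : 2 * ∫⁻ z in Ioc b 1, jumpKernel H y z =
      ENNReal.ofReal (H * ((b - y) ^ (2 * H - 1) - (1 - y) ^ (2 * H - 1))) := by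
  have e : ∀ z ∈ Ioc b 1, jumpKernel H y z =
      ENNReal.ofReal (1 / 2) * ENNReal.ofReal (H * ((1 - 2 * H) * (z - y) ^ (2 * H - 2))) := by
    intro z hz
    rw [jumpKernel, ← ENNReal.ofReal_mul (by norm_num), abs_sub_comm,
      abs_of_pos (by linarith [hz.1])]
    congr 1; ring
  have hd : ∀ z ∈ uIcc b 1, HasDerivAt (fun z => -(H * (z - y) ^ (2 * H - 1)))
      (H * ((1 - 2 * H) * (z - y) ^ (2 * H - 2))) z := by
    intro z hz
    rw [uIcc_of_le hb] at hz
    have h1 : HasDerivAt (fun z : ℝ => z - y) 1 z := (hasDerivAt_id z).sub_const y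
    have := ((h1.rpow_const (p := 2 * H - 1) (Or.inl (by linarith [hz.1]))).const_mul H).neg
    refine this.congr_deriv ?_
    rw [show 2 * H - 1 - 1 = 2 * H - 2 by ring]; ring
  have hc : ContinuousOn (fun z => H * ((1 - 2 * H) * (z - y) ^ (2 * H - 2))) (uIcc b 1) := by
    refine continuousOn_const.mul (continuousOn_const.mul ?_)
    refine ContinuousOn.rpow_const (by fun_prop) fun z hz => Or.inl ?_
    rw [uIcc_of_le hb] at hz
    linarith [hz.1]
  have hi := hc.intervalIntegrable (μ := volume)
  have hI := intervalIntegral.integral_eq_sub_of_hasDerivAt hd hi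
  rw [setLIntegral_congr_fun measurableSet_Ioc e, lintegral_const_mul' _ _ ENNReal.ofReal_ne_top,
    ← ofReal_integral_eq_lintegral_ofReal, ← intervalIntegral.integral_of_le hb, hI, ← mul_assoc,
    ← ENNReal.ofReal_ofNat 2, ← ENNReal.ofReal_mul (by norm_num)]
  · norm_num
    ring_nf
  · exact (intervalIntegrable_iff_integrableOn_Ioc_of_le hb).1 hi
  · refine (ae_restrict_iff' measurableSet_Ioc).2 (Eventually.of_forall fun z hz => ?_)
    have := Real.rpow_nonneg (show 0 ≤ z - y by linarith [hz.1]) (2 * H - 2)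
    have : 0 ≤ 1 - 2 * H := by linarith
    positivity

lemma volD_eq_Ioc : volD = volume.restrict (Ioc (0 : ℝ) 1) := restrict_Ioo_eq_restrict_Ioc

/-- The boundary weight is chosen for this cancellation: it removes the terms `y^(2H-1)` and
`(1-y)^(2H-1)` left over at the ends of `(0, 1)`. For `H < 1/2` it is the mass of the jumps leaving
`(0, 1)`, so the result depends only on the distances to `a` and `b`. For `H = 1/2` the kernel
vanishes and the weight is `1`. -/
lemma lintegral_compl_jumpKernel_add {H : ℝ} (hH0 : 0 < H) (hH : H ≤ 1 / 2) {a b y : ℝ}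
    (ha : 0 ≤ a) (hb : b ≤ 1) (hy : y ∈ Ioo a b) :
    2 * (∫⁻ z, jumpKernel H y z * (Ioc a b)ᶜ.indicator 1 z ∂volD) + killingWeight H y =
      ENNReal.ofReal (H * ((y - a) ^ (2 * H - 1) + (b - y) ^ (2 * H - 1))) := by
  have hab := hy.1.trans hy.2
  have e : ∫⁻ z, jumpKernel H y z * (Ioc a b)ᶜ.indicator 1 z ∂volD =
      (∫⁻ z in Ioc 0 a, jumpKernel H y z) + ∫⁻ z in Ioc b 1, jumpKernel H y z := by
    have : (fun z => jumpKernel H y z * (Ioc a b)ᶜ.indicator 1 z) =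
        (Ioc a b)ᶜ.indicator (fun z => jumpKernel H y z) := by
      ext z; by_cases hz : z ∈ (Ioc a b)ᶜ <;> simp [hz]
    rw [this, lintegral_indicator measurableSet_Ioc.compl, volD_eq_Ioc,
      Measure.restrict_restrict measurableSet_Ioc.compl, ← lintegral_union measurableSet_Ioc]
    · congr 2
      ext z
      simp only [mem_inter_iff, mem_compl_iff, mem_Ioc, mem_union, not_and, not_le]
      constructor
      · rintro ⟨h1, h2⟩
        by_cases h : a < z
        · exact Or.inr ⟨h1 h, h2.2⟩
        · exact Or.inl ⟨h2.1, not_lt.1 h⟩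
      · rintro (⟨h1, h2⟩ | ⟨h1, h2⟩)
        · exact ⟨fun h => by linarith, h1, by linarith⟩
        · exact ⟨fun h => h1, by linarith, h2⟩
    · rw [Set.disjoint_left]
      intro z h1 h2
      linarith [h1.2, h2.1]
  rw [e, mul_add, lintegral_left_jumpKernel hH0 hH ha hy.1,
    lintegral_right_jumpKernel hH0 hH hb hy.2, killingWeight, ← ENNReal.ofReal_add,
    ← ENNReal.ofReal_add]
  · congr 1; ring
  · have h1 : y ^ (2 * H - 1) ≤ (y - a) ^ (2 * H - 1) :=
      Real.rpow_le_rpow_of_nonpos (by linarith [hy.1]) (by linarith) (by linarith)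
    have h2 : (1 - y) ^ (2 * H - 1) ≤ (b - y) ^ (2 * H - 1) :=
      Real.rpow_le_rpow_of_nonpos (by linarith [hy.2]) (by linarith) (by linarith)
    have := mul_nonneg hH0.le (sub_nonneg.2 h1)
    have := mul_nonneg hH0.le (sub_nonneg.2 h2)
    linarith
  · have h1 := Real.rpow_nonneg (show 0 ≤ y by linarith [hy.1]) (2 * H - 1)
    have h2 := Real.rpow_nonneg (show 0 ≤ 1 - y by linarith [hy.2]) (2 * H - 1)
    positivity
  · have h1 : y ^ (2 * H - 1) ≤ (y - a) ^ (2 * H - 1) :=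
      Real.rpow_le_rpow_of_nonpos (by linarith [hy.1]) (by linarith) (by linarith)
    exact mul_nonneg hH0.le (sub_nonneg.2 h1)
  · have h2 : (1 - y) ^ (2 * H - 1) ≤ (b - y) ^ (2 * H - 1) :=
      Real.rpow_le_rpow_of_nonpos (by linarith [hy.2]) (by linarith) (by linarith)
    exact mul_nonneg hH0.le (sub_nonneg.2 h2)

lemma lintegral_rpow_sub_add {H : ℝ} (hH0 : 0 < H) {a b : ℝ} (hab : a ≤ b) :
    ∫⁻ y in Ioc a b, ENNReal.ofReal (H * ((y - a) ^ (2 * H - 1) + (b - y) ^ (2 * H - 1))) =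
      ENNReal.ofReal ((b - a) ^ (2 * H)) := by
  have i1 : IntervalIntegrable (fun y => (y - a) ^ (2 * H - 1)) volume a b := by
    have := (intervalIntegral.intervalIntegrable_rpow' (a := 0) (b := b - a)
      (show -1 < 2 * H - 1 by linarith)).comp_sub_right a
    simpa using this
  have i2 : IntervalIntegrable (fun y => (b - y) ^ (2 * H - 1)) volume a b := by
    have := (intervalIntegral.intervalIntegrable_rpow' (a := b - a) (b := 0)
      (show -1 < 2 * H - 1 by linarith)).comp_sub_left b
    simpa using this
  have hi := (i1.add i2).const_mul H
  rw [← ofReal_integral_eq_lintegral_ofReal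
    ((intervalIntegrable_iff_integrableOn_Ioc_of_le hab).1 hi),
    ← intervalIntegral.integral_of_le hab, intervalIntegral.integral_const_mul,
    intervalIntegral.integral_add i1 i2,
    intervalIntegral.integral_comp_sub_right (fun x => x ^ (2 * H - 1)),
    intervalIntegral.integral_comp_sub_left (fun x => x ^ (2 * H - 1)),
    integral_rpow (Or.inl (by linarith)), integral_rpow (Or.inl (by linarith))]
  · simp only [sub_self, sub_add_cancel]
    rw [Real.zero_rpow (by linarith)]
    congr 1
    field_simp
    ring
  · refine (ae_restrict_iff' measurableSet_Ioc).2 (Eventually.of_forall fun z hz => ?_)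
    have := Real.rpow_nonneg (show 0 ≤ z - a by linarith [hz.1]) (2 * H - 1)
    have := Real.rpow_nonneg (show 0 ≤ b - z by linarith [hz.2]) (2 * H - 1)
    positivity

/-- The squared difference is `1` exactly when one point lies in `A` and the other does not;
symmetry of the kernel merges the two cases into a factor 2. On the boundary part `0 ∉ A` leaves the
indicator of `A` alone. -/
lemma lintegral_sq_indicator_sub_energyMeasure (H : ℝ) {A : Set ℝ} (hA : MeasurableSet A)
    (h0 : (0 : ℝ) ∉ A) :
    ∫⁻ p, ENNReal.ofReal ((A.indicator (fun _ => (1 : ℝ)) p.1 -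
      A.indicator (fun _ => (1 : ℝ)) p.2) ^ 2) ∂energyMeasure H =
      ∫⁻ y in A, (2 * (∫⁻ z, jumpKernel H y z * Aᶜ.indicator 1 z ∂volD) + killingWeight H y)
        ∂volD := by
  have hm : Measurable (A.indicator (fun _ => (1 : ℝ))) := measurable_const.indicator hA
  have hm1 : Measurable (A.indicator (1 : ℝ → ℝ≥0∞)) := measurable_one.indicator hA
  have hm2 : Measurable (Aᶜ.indicator (1 : ℝ → ℝ≥0∞)) := measurable_one.indicator hA.compl
  have e : ∀ y z, ENNReal.ofReal ((A.indicator (fun _ => (1 : ℝ)) y -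
      A.indicator (fun _ => (1 : ℝ)) z) ^ 2) =
      A.indicator 1 y * Aᶜ.indicator 1 z + Aᶜ.indicator 1 y * A.indicator 1 z := by
    intro y z
    by_cases hy : y ∈ A <;> by_cases hz : z ∈ A <;> simp [hy, hz]
  have hk := measurable_jumpKernel H
  have hsw : ∫⁻ y, ∫⁻ z, jumpKernel H y z * (Aᶜ.indicator 1 y * A.indicator 1 z) ∂volD ∂volD =
      ∫⁻ y, ∫⁻ z, jumpKernel H y z * (A.indicator 1 y * Aᶜ.indicator 1 z) ∂volD ∂volD := by
    rw [lintegral_lintegral_swap]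
    · refine lintegral_congr fun y => lintegral_congr fun z => ?_
      rw [jumpKernel_comm, mul_comm (Aᶜ.indicator 1 z)]
    · exact (hk.mul ((hm2.comp measurable_fst).mul (hm1.comp measurable_snd))).aemeasurable
  have hky : ∀ y, Measurable (fun z => jumpKernel H y z) := fun y => by
    unfold jumpKernel; fun_prop
  have hin : Measurable (fun y => ∫⁻ z, jumpKernel H y z * (A.indicator 1 y * Aᶜ.indicator 1 z)
      ∂volD) :=
    Measurable.lintegral_prod_right' (f := fun p : ℝ × ℝ =>
      jumpKernel H p.1 p.2 * (A.indicator 1 p.1 * Aᶜ.indicator 1 p.2))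
      (hk.mul ((hm1.comp measurable_fst).mul (hm2.comp measurable_snd)))
  have hsplit : ∀ y, ∫⁻ z, (jumpKernel H y z * (A.indicator 1 y * Aᶜ.indicator 1 z) +
      jumpKernel H y z * (Aᶜ.indicator 1 y * A.indicator 1 z)) ∂volD =
      (∫⁻ z, jumpKernel H y z * (A.indicator 1 y * Aᶜ.indicator 1 z) ∂volD) +
      ∫⁻ z, jumpKernel H y z * (Aᶜ.indicator 1 y * A.indicator 1 z) ∂volD := fun y =>
    lintegral_add_left ((hky y).mul (measurable_const.mul hm2)) _
  rw [lintegral_energyMeasure H (by fun_prop)]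
  simp_rw [e, mul_add, hsplit]
  rw [lintegral_add_left hin, hsw, ← two_mul, ← lintegral_const_mul _ hin,
    ← lintegral_add_left (hin.const_mul 2), ← lintegral_indicator hA]
  refine lintegral_congr fun y => ?_
  by_cases hy : y ∈ A
  · simp [hy, h0]
  · simp [hy, h0]

/-- The indicator function of an interval `s` has energy `|s| ^ (2H)`. -/
lemma lintegral_indicator_energyMeasure {H : ℝ} (hH0 : 0 < H) (hH : H ≤ 1 / 2) {a b : ℝ}
    (ha : 0 ≤ a) (hab : a ≤ b) (hb : b ≤ 1) :
    ∫⁻ p, ENNReal.ofReal (((Ioc a b).indicator (fun _ => (1 : ℝ)) p.1 -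
      (Ioc a b).indicator (fun _ => (1 : ℝ)) p.2) ^ 2) ∂energyMeasure H =
      ENNReal.ofReal ((b - a) ^ (2 * H)) := by
  rw [lintegral_sq_indicator_sub_energyMeasure H measurableSet_Ioc (fun h => by linarith [h.1]),
    ← lintegral_rpow_sub_add hH0 hab]
  have hr : volD.restrict (Ioc a b) = volume.restrict (Ioo a b) := by
    rw [volD_eq_Ioc, Measure.restrict_restrict measurableSet_Ioc,
      inter_eq_left.2 (Ioc_subset_Ioc ha hb), restrict_Ioo_eq_restrict_Ioc]
  rw [hr, ← restrict_Ioo_eq_restrict_Ioc]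
  exact setLIntegral_congr_fun measurableSet_Ioo fun y hy =>
    lintegral_compl_jumpKernel_add hH0 hH ha hb hy

/-! ### The covariance of `W` as an inner product in the energy space -/

/-- The difference function `(y, z) ↦ φ y - φ z`. -/
def diffFn (φ : ℝ → ℝ) (p : ℝ × ℝ) : ℝ := φ p.1 - φ p.2

lemma measurable_diffFn {φ : ℝ → ℝ} (h : Measurable φ) : Measurable (diffFn φ) := by
  unfold diffFn; fun_prop

/-- The indicator function of `(0, a]`. -/
noncomputable def initInd (a : ℝ) : ℝ → ℝ := (Ioc 0 a).indicator fun _ => 1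

lemma measurable_initInd (a : ℝ) : Measurable (initInd a) :=
  measurable_const.indicator measurableSet_Ioc

lemma initInd_sub {a b : ℝ} (ha : 0 ≤ a) (hab : a ≤ b) (x : ℝ) :
    initInd b x - initInd a x = (Ioc a b).indicator (fun _ => (1 : ℝ)) x := by
  unfold initInd
  simp only [indicator, mem_Ioc]
  by_cases h0 : 0 < x
  · by_cases h1 : x ≤ a
    · simp [h0, h1, h1.trans hab, not_lt.2 h1]
    · simp [h0, h1, not_le.1 h1]
  · simp only [h0, false_and, if_false, sub_zero]
    rw [if_neg fun h => h0 (ha.trans_lt h.1)]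

lemma integrable_sq_diffFn {H : ℝ} (hH0 : 0 < H) (hH : H ≤ 1 / 2) {a b : ℝ}
    (ha : 0 ≤ a) (hab : a ≤ b) (hb : b ≤ 1) :
    Integrable (fun p => (diffFn (initInd b) p - diffFn (initInd a) p) ^ 2) (energyMeasure H) ∧
    ∫ p, (diffFn (initInd b) p - diffFn (initInd a) p) ^ 2 ∂energyMeasure H =
      (b - a) ^ (2 * H) := by
  have h := lintegral_indicator_energyMeasure hH0 hH ha hab hb
  have hm : AEStronglyMeasurable (fun p => (diffFn (initInd b) p - diffFn (initInd a) p) ^ 2)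
      (energyMeasure H) := (((measurable_diffFn (measurable_initInd b)).sub
    (measurable_diffFn (measurable_initInd a))).pow_const 2).aestronglyMeasurable
  have e : ∀ p, (diffFn (initInd b) p - diffFn (initInd a) p) ^ 2 =
      ((Ioc a b).indicator (fun _ => (1 : ℝ)) p.1 -
      (Ioc a b).indicator (fun _ => (1 : ℝ)) p.2) ^ 2 := by
    intro p
    rw [← initInd_sub ha hab, ← initInd_sub ha hab]
    unfold diffFn
    ring
  simp_rw [← e] at h
  refine ⟨(lintegral_ofReal_ne_top_iff_integrable hm
    (Eventually.of_forall fun p => sq_nonneg _)).1 (by rw [h]; exact ENNReal.ofReal_ne_top), ?_⟩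
  rw [integral_eq_lintegral_of_nonneg_ae (Eventually.of_forall fun p => sq_nonneg _) hm]
  refine (congrArg ENNReal.toReal h).trans (ENNReal.toReal_ofReal ?_)
  exact Real.rpow_nonneg (by linarith) _

lemma diffFn_initInd_zero : diffFn (initInd 0) = 0 := by
  ext p; simp [diffFn, initInd]

lemma memLp_diffFn_initInd {H : ℝ} (hH0 : 0 < H) (hH : H ≤ 1 / 2) {a : ℝ}
    (ha : a ∈ Icc (0 : ℝ) 1) : MemLp (diffFn (initInd a)) 2 (energyMeasure H) := by
  have h := (integrable_sq_diffFn hH0 hH le_rfl ha.1 ha.2).1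
  simp only [diffFn_initInd_zero, Pi.zero_apply, sub_zero] at h
  exact (memLp_two_iff_integrable_sq
    (measurable_diffFn (measurable_initInd a)).aestronglyMeasurable).2 h

/-- Polarisation: `2ab = a² + b² - (b - a)²`, where the three squares are the energies of `(0, a]`,
`(0, b]` and the interval between their end points. -/
lemma integral_diffFn_initInd_mul {H : ℝ} (hH0 : 0 < H) (hH : H ≤ 1 / 2) {a b : ℝ}
    (ha : a ∈ Icc (0 : ℝ) 1) (hb : b ∈ Icc (0 : ℝ) 1) :
    ∫ p, diffFn (initInd a) p * diffFn (initInd b) p ∂energyMeasure H =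
      (a ^ (2 * H) + b ^ (2 * H) - |a - b| ^ (2 * H)) / 2 := by
  have key : ∀ a ∈ Icc (0 : ℝ) 1, ∀ b ∈ Icc (0 : ℝ) 1, a ≤ b →
      ∫ p, diffFn (initInd a) p * diffFn (initInd b) p ∂energyMeasure H =
      (a ^ (2 * H) + b ^ (2 * H) - |a - b| ^ (2 * H)) / 2 := by
    intro a ha b hb hab
    have h1 := integrable_sq_diffFn hH0 hH le_rfl ha.1 ha.2
    have h2 := integrable_sq_diffFn hH0 hH le_rfl hb.1 hb.2
    have h3 := integrable_sq_diffFn hH0 hH ha.1 hab hb.2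
    simp only [diffFn_initInd_zero, Pi.zero_apply, sub_zero] at h1 h2
    have e : ∀ p, diffFn (initInd a) p * diffFn (initInd b) p = (diffFn (initInd a) p ^ 2 +
        diffFn (initInd b) p ^ 2 - (diffFn (initInd b) p - diffFn (initInd a) p) ^ 2) / 2 := by
      intro p; ring
    simp_rw [e]
    have h12 : Integrable (fun p => diffFn (initInd a) p ^ 2 + diffFn (initInd b) p ^ 2)
      (energyMeasure H) := h1.1.add h2.1
    rw [integral_div, integral_sub h12 h3.1, integral_add h1.1 h2.1, h1.2, h2.2,
      h3.2, abs_sub_comm, abs_of_nonneg (sub_nonneg.2 hab)]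
  rcases le_total a b with hab | hab
  · exact key a ha b hb hab
  · simp_rw [mul_comm (diffFn (initInd a) _)]
    rw [key b hb a ha hab, abs_sub_comm]
    ring

/-! ### The Itô isometry for step functions -/

section Isometry

variable {Ω : Type*} [MeasurableSpace Ω]

/-- The pairs of corresponding elements of the Gaussian space of `W` and of the energy space. -/
def wienerPairs {Ω : Type*} (W : ℝ → Ω → ℝ) : Submodule ℝ ((Ω → ℝ) × (ℝ × ℝ → ℝ)) :=
  Submodule.span ℝ {q | ∃ a ∈ Icc (0 : ℝ) 1, q = (W a, diffFn (initInd a))}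

lemma IsFBM.memLp {P : Measure Ω} {H : ℝ} {W : ℝ → Ω → ℝ} (hW : IsFBM P H W) {a : ℝ}
    (ha : a ∈ Icc (0 : ℝ) 1) : MemLp (W a) 2 P :=
  (hW.gaussian.hasGaussianLaw_eval ⟨a, ha⟩).memLp_two

lemma memLp_of_mem_wienerPairs {P : Measure Ω} {H : ℝ} (hH0 : 0 < H) (hH : H ≤ 1 / 2)
    {W : ℝ → Ω → ℝ} (hW : IsFBM P H W) {q : (Ω → ℝ) × (ℝ × ℝ → ℝ)} (hq : q ∈ wienerPairs W) :
    MemLp q.1 2 P ∧ MemLp q.2 2 (energyMeasure H) := by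
  induction hq using Submodule.span_induction with
  | mem x hx =>
    obtain ⟨a, ha, rfl⟩ := hx
    exact ⟨hW.memLp ha, memLp_diffFn_initInd hH0 hH ha⟩
  | zero => exact ⟨MemLp.zero, MemLp.zero⟩
  | add x y _ _ h1 h2 => exact ⟨h1.1.add h2.1, h1.2.add h2.2⟩
  | smul c x _ h => exact ⟨h.1.const_smul c, h.2.const_smul c⟩

/-- Both sides are bilinear, so it suffices to compare generators, where both equal the fractional
covariance. Working in a span of pairs makes it unnecessary to show that a linear map from one space
to the other is well defined. -/
lemma integral_mul_of_mem_wienerPairs {P : Measure Ω} {H : ℝ} (hH0 : 0 < H) (hH : H ≤ 1 / 2)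
    {W : ℝ → Ω → ℝ} (hW : IsFBM P H W) {q r : (Ω → ℝ) × (ℝ × ℝ → ℝ)} (hq : q ∈ wienerPairs W)
    (hr : r ∈ wienerPairs W) :
    ∫ ω, q.1 ω * r.1 ω ∂P = ∫ p, q.2 p * r.2 p ∂energyMeasure H := by
  have hI : ∀ q ∈ wienerPairs W, ∀ r ∈ wienerPairs W, Integrable (fun ω => q.1 ω * r.1 ω) P ∧
      Integrable (fun p => q.2 p * r.2 p) (energyMeasure H) := fun q hq r hr =>
    have h1 := memLp_of_mem_wienerPairs hH0 hH hW hq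
    have h2 := memLp_of_mem_wienerPairs hH0 hH hW hr
    ⟨h1.1.integrable_mul h2.1, h1.2.integrable_mul h2.2⟩
  induction hq, hr using Submodule.span_induction₂ with
  | mem_mem x y hx hy =>
    obtain ⟨a, ha, rfl⟩ := hx
    obtain ⟨b, hb, rfl⟩ := hy
    rw [hW.cov a ha b hb, integral_diffFn_initInd_mul hH0 hH ha hb]
  | zero_left y hy => simp
  | zero_right x hx => simp
  | add_left x y z hx hy hz h1 h2 =>
    simp only [Prod.fst_add, Prod.snd_add, Pi.add_apply, add_mul]
    rw [integral_add (hI x hx z hz).1 (hI y hy z hz).1,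
      integral_add (hI x hx z hz).2 (hI y hy z hz).2, h1, h2]
  | add_right x y z hx hy hz h1 h2 =>
    simp only [Prod.fst_add, Prod.snd_add, Pi.add_apply, mul_add]
    rw [integral_add (hI x hx y hy).1 (hI x hx z hz).1,
      integral_add (hI x hx y hy).2 (hI x hx z hz).2, h1, h2]
  | smul_left c x y hx hy h =>
    simp only [Prod.smul_fst, Prod.smul_snd, Pi.smul_apply, smul_eq_mul, mul_assoc]
    rw [integral_const_mul, integral_const_mul, h]
  | smul_right c x y hx hy h =>
    simp only [Prod.smul_fst, Prod.smul_snd, Pi.smul_apply, smul_eq_mul, mul_left_comm _ c]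
    rw [integral_const_mul, integral_const_mul, h]

lemma eLpNorm_of_mem_wienerPairs {P : Measure Ω} {H : ℝ} (hH0 : 0 < H) (hH : H ≤ 1 / 2)
    {W : ℝ → Ω → ℝ} (hW : IsFBM P H W) {q : (Ω → ℝ) × (ℝ × ℝ → ℝ)} (hq : q ∈ wienerPairs W) :
    eLpNorm q.1 2 P = eLpNorm q.2 2 (energyMeasure H) := by
  have h := memLp_of_mem_wienerPairs hH0 hH hW hq
  have e := integral_mul_of_mem_wienerPairs hH0 hH hW hq hq
  rw [h.1.eLpNorm_eq_integral_rpow_norm (by norm_num) (by norm_num),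
    h.2.eLpNorm_eq_integral_rpow_norm (by norm_num) (by norm_num)]
  simp only [ENNReal.toReal_ofNat, Real.rpow_ofNat, Real.norm_eq_abs, sq_abs]
  simp only [sq, e]

lemma StepFn.mem_Icc (s : StepFn) {j : ℕ} (hj : j ≤ s.N) : s.a j ∈ Icc (0 : ℝ) 1 := by
  have hmono : MonotoneOn s.a (Iic s.N) :=
    monotoneOn_of_le_succ ordConnected_Iic fun j _ _ h => (s.a_lt j h).le
  exact ⟨s.a_zero ▸ hmono (Nat.zero_le _) hj (Nat.zero_le _),
    s.a_last ▸ hmono hj (mem_Iic.2 le_rfl) hj⟩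

lemma StepFn.mem_wienerPairs {Ω : Type*} (W : ℝ → Ω → ℝ) (s : StepFn) :
    (s.integral W, diffFn s.toFun) ∈ wienerPairs W := by
  have e : (s.integral W, diffFn s.toFun) = ∑ j ∈ Finset.range s.N, s.coeff j •
      ((W (s.a (j + 1)), diffFn (initInd (s.a (j + 1)))) - (W (s.a j), diffFn (initInd (s.a j)))) := by
    ext ω
    · simp [StepFn.integral, Prod.fst_sum]
    · simp only [Prod.snd_sum, Finset.sum_apply, Prod.smul_snd, Prod.snd_sub, Pi.smul_apply,
        Pi.sub_apply, smul_eq_mul]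
      simp only [diffFn, StepFn.toFun, ← Finset.sum_sub_distrib]
      refine Finset.sum_congr rfl fun j hj => ?_
      have hj := Finset.mem_range.1 hj
      have h1 : ∀ x, (Ioc (s.a j) (s.a (j + 1))).indicator (fun _ => s.coeff j) x =
          s.coeff j * (initInd (s.a (j + 1)) x - initInd (s.a j) x) := by
        intro x
        rw [initInd_sub (s.mem_Icc hj.le).1 (s.a_lt j hj).le]
        simp [indicator]
      rw [h1, h1]
      ring
  rw [e]
  refine Submodule.sum_mem _ fun j hj => Submodule.smul_mem _ _ (Submodule.sub_mem _ ?_ ?_)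
  · exact Submodule.subset_span ⟨_, s.mem_Icc (Finset.mem_range.1 hj), rfl⟩
  · exact Submodule.subset_span ⟨_, s.mem_Icc (Finset.mem_range.1 hj).le, rfl⟩

/-- The Itô isometry for differences of step functions. -/
lemma eLpNorm_integral_sub {P : Measure Ω} {H : ℝ} (hH0 : 0 < H) (hH : H ≤ 1 / 2)
    {W : ℝ → Ω → ℝ} (hW : IsFBM P H W) (s t : StepFn) :
    eLpNorm (s.integral W - t.integral W) 2 P =
      eLpNorm (diffFn s.toFun - diffFn t.toFun) 2 (energyMeasure H) := by
  have h : (s.integral W - t.integral W, diffFn s.toFun - diffFn t.toFun) ∈ wienerPairs W := by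
    rw [← Prod.mk_sub_mk]
    exact Submodule.sub_mem _ (s.mem_wienerPairs W) (t.mem_wienerPairs W)
  have := eLpNorm_of_mem_wienerPairs hH0 hH hW h
  exact this

lemma StepFn.memLp_integral {P : Measure Ω} {H : ℝ} (hH0 : 0 < H) (hH : H ≤ 1 / 2)
    {W : ℝ → Ω → ℝ} (hW : IsFBM P H W) (s : StepFn) : MemLp (s.integral W) 2 P :=
  (memLp_of_mem_wienerPairs hH0 hH hW (s.mem_wienerPairs W)).1

lemma StepFn.measurable_toFun (s : StepFn) : Measurable s.toFun := by
  unfold StepFn.toFun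
  exact Finset.measurable_sum _ fun j _ => measurable_const.indicator measurableSet_Ioc

lemma StepFn.toFun_zero (s : StepFn) : s.toFun 0 = 0 := by
  refine Finset.sum_eq_zero fun j hj => indicator_of_notMem (fun h => ?_) _
  linarith [h.1, (s.mem_Icc (Finset.mem_range.1 hj).le).1]

end Isometry

/-! ### Extension of the energy bound to Wiener integrals -/

/-- Properties which hold almost everywhere on `(0, 1)` and at `0` hold for both coordinates
almost everywhere for the energy measure. -/
lemma ae_energyMeasure {H : ℝ} {p : ℝ → Prop} (h : ∀ᵐ x ∂volD, p x) (h0 : p 0) :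
    ∀ᵐ q ∂energyMeasure H, p q.1 ∧ p q.2 := by
  unfold energyMeasure
  rw [ae_add_measure_iff]
  constructor
  · refine (withDensity_absolutelyContinuous _ _).ae_le ?_
    filter_upwards [Measure.quasiMeasurePreserving_fst.ae h,
      Measure.quasiMeasurePreserving_snd.ae h] with q h1 h2 using ⟨h1, h2⟩
  · have h' : ∀ᵐ x ∂(volD.withDensity (killingWeight H)), p x :=
      (withDensity_absolutelyContinuous _ _).ae_le h
    have hm : Measurable (fun y : ℝ => (y, (0 : ℝ))) := by fun_prop
    -- The predicate `p` need not be measurable, so it is replaced by a measurable set of full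
    -- measure before passing to the image measure.
    obtain ⟨t, ht, htm, htp⟩ : ∃ t, (∀ x ∈ t, p x) ∧ MeasurableSet t ∧
        ∀ᵐ x ∂(volD.withDensity (killingWeight H)), x ∈ t := by
      obtain ⟨t, hsub, htm, ht0⟩ := exists_measurable_superset_of_null (ae_iff.1 h')
      refine ⟨tᶜ, fun x hx => by_contra fun hp => hx (hsub hp), htm.compl, ?_⟩
      rw [ae_iff]; simpa using ht0
    have : ∀ᵐ q ∂(volD.withDensity (killingWeight H)).map (fun y => (y, (0 : ℝ))),
        q.1 ∈ t ∧ q.2 = 0 := by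
      rw [ae_map_iff hm.aemeasurable]
      · filter_upwards [htp] with x hx using ⟨hx, rfl⟩
      · exact (measurable_fst htm).inter (measurable_snd (measurableSet_singleton 0))
    filter_upwards [this] with q hq
    exact ⟨ht _ hq.1, hq.2 ▸ h0⟩

/-- The distance of a Wiener integral to an elementary one is at most the energy distance of the
integrands. -/
lemma IsWienerIntegral.eLpNorm_sub_le {Ω : Type*} [MeasurableSpace Ω] {P : Measure Ω} {H : ℝ}
    (hH0 : 0 < H) (hH : H ≤ 1 / 2) {W : ℝ → Ω → ℝ} (hW : IsFBM P H W) {φ : ℝ → ℝ}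
    (hφm : Measurable φ) (hφ0 : φ 0 = 0) {X : Ω → ℝ} (hX : IsWienerIntegral P W φ X) (t : StepFn) :
    eLpNorm (X - t.integral W) 2 P ≤
      eLpNorm (diffFn φ - diffFn t.toFun) 2 (energyMeasure H) := by
  obtain ⟨_, hX2, s, hs, hI⟩ := hX
  have hsm : ∀ s : StepFn, AEStronglyMeasurable (diffFn s.toFun) (energyMeasure H) := fun s =>
    (measurable_diffFn s.measurable_toFun).aestronglyMeasurable
  have hφm' : AEStronglyMeasurable (diffFn φ) (energyMeasure H) :=
    (measurable_diffFn hφm).aestronglyMeasurable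
  have hIm : ∀ s : StepFn, AEStronglyMeasurable (s.integral W) P := fun s =>
    (s.memLp_integral hH0 hH hW).1
  -- `L²(0, 1)` convergence of the integrands does not give convergence in energy, but a subsequence
  -- converges almost everywhere. This carries over to the difference functions, since every
  -- integrand vanishes at `0`.
  obtain ⟨ns, hns, hae⟩ := (tendstoInMeasure_of_tendsto_eLpNorm two_ne_zero
    (fun k => (s k).measurable_toFun.aestronglyMeasurable) hφm.aestronglyMeasurable
    hs).exists_seq_tendsto_ae
  have hae' : ∀ᵐ q ∂energyMeasure H, Tendsto (fun i => diffFn (s (ns i)).toFun q) atTop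
      (𝓝 (diffFn φ q)) := by
    filter_upwards [ae_energyMeasure (H := H) hae (by simp [StepFn.toFun_zero, hφ0])] with q hq
    exact hq.1.sub hq.2
  have hI' : Tendsto (fun k => eLpNorm ((s k).integral W - X) 2 P) atTop (𝓝 0) := hI
  -- Fatou along the subsequence, then the isometry: the energy distance of `s k` to `φ` is at most
  -- the lower limit of the `L²(P)` distances between `I(s k)` and `I(s (ns i))`, and `I(s (ns i))`
  -- tends to `X`.
  have hfatou : ∀ k, eLpNorm (diffFn (s k).toFun - diffFn φ) 2 (energyMeasure H) ≤
      eLpNorm ((s k).integral W - X) 2 P := by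
    intro k
    refine (Lp.eLpNorm_lim_le_liminf_eLpNorm
      (f := fun i => diffFn (s k).toFun - diffFn (s (ns i)).toFun)
      (fun i => (hsm _).sub (hsm _)) _ ?_).trans ?_
    · filter_upwards [hae'] with q hq using hq.const_sub _
    · have hlim : Tendsto (fun i => eLpNorm ((s k).integral W - X) 2 P +
          eLpNorm ((s (ns i)).integral W - X) 2 P) atTop
          (𝓝 (eLpNorm ((s k).integral W - X) 2 P)) := by
        simpa using (hI'.comp hns.tendsto_atTop).const_add (eLpNorm ((s k).integral W - X) 2 P)
      rw [← hlim.liminf_eq]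
      refine liminf_le_liminf (Eventually.of_forall fun i => ?_)
      rw [← eLpNorm_integral_sub hH0 hH hW, eLpNorm_sub_comm ((s (ns i)).integral W) X]
      refine le_trans (le_of_eq ?_) (eLpNorm_add_le ((hIm _).sub hX2.1) (hX2.1.sub (hIm _))
        (by norm_num))
      congr 1
      abel
  -- Triangle inequalities through `s k` on both sides of the isometry; each costs one copy of an
  -- error that tends to `0`.
  have hbound : ∀ k, eLpNorm (X - t.integral W) 2 P ≤ 2 * eLpNorm ((s k).integral W - X) 2 P +
      eLpNorm (diffFn φ - diffFn t.toFun) 2 (energyMeasure H) := by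
    intro k
    have h1 := eLpNorm_add_le (hX2.1.sub (hIm (s k))) ((hIm (s k)).sub (hIm t))
      (p := 2) (by norm_num)
    have h2 := eLpNorm_add_le ((hsm (s k)).sub hφm') (hφm'.sub (hsm t)) (p := 2) (by norm_num)
    rw [sub_add_sub_cancel] at h1 h2
    rw [eLpNorm_sub_comm X (StepFn.integral W (s k)), eLpNorm_integral_sub hH0 hH hW] at h1
    calc _ ≤ _ := h1
      _ ≤ _ := add_le_add le_rfl (h2.trans (add_le_add (hfatou k) le_rfl))
      _ = _ := by rw [two_mul, add_assoc]
  have hlim : Tendsto (fun k => 2 * eLpNorm ((s k).integral W - X) 2 P +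
      eLpNorm (diffFn φ - diffFn t.toFun) 2 (energyMeasure H)) atTop
      (𝓝 (eLpNorm (diffFn φ - diffFn t.toFun) 2 (energyMeasure H))) := by
    simpa using (ENNReal.Tendsto.const_mul hI' (Or.inr (by norm_num))).add_const
      (eLpNorm (diffFn φ - diffFn t.toFun) 2 (energyMeasure H))
  exact ge_of_tendsto' hlim hbound

/-! ### Energy distance of a Lipschitz function to its cell averages -/

lemma eLpNorm_two_sq {α : Type*} [MeasurableSpace α] (μ : Measure α) (F : α → ℝ) :
    eLpNorm F 2 μ ^ 2 = ∫⁻ x, ENNReal.ofReal (F x ^ 2) ∂μ := by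
  have h := eLpNorm_nnreal_pow_eq_lintegral (f := F) (μ := μ) (p := 2) two_ne_zero
  simp only [NNReal.coe_ofNat, ENNReal.rpow_ofNat, ENNReal.coe_ofNat] at h
  rw [h]
  refine lintegral_congr fun x => ?_
  rw [← ofReal_norm, ← ENNReal.ofReal_pow (norm_nonneg _), Real.norm_eq_abs, sq_abs]

/-- The piecewise constant function of the averages of `φ` over the cells of the uniform grid. -/
noncomputable def cellAverage (φ : ℝ → ℝ) {n : ℕ} (hn : 1 ≤ n) : StepFn where
  N := n
  a j := (j : ℝ) / n
  coeff j := n * ∫ y in ((j : ℝ) / n)..(((j : ℝ) + 1) / n), φ y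
  a_zero := by simp
  a_last := div_self (by positivity)
  a_lt j _ := by
    have : (0 : ℝ) < n := by exact_mod_cast hn
    gcongr
    simp

/-- The cells of the uniform grid. -/
def cell (n j : ℕ) : Set ℝ := Ioc ((j : ℝ) / n) (((j : ℝ) + 1) / n)

lemma mem_cell_iff {n : ℕ} (hn : 1 ≤ n) {j : ℕ} {y : ℝ} :
    y ∈ cell n j ↔ (j : ℝ) < y * n ∧ y * n ≤ j + 1 := by
  have : (0 : ℝ) < n := by exact_mod_cast hn
  rw [cell, mem_Ioc, div_lt_iff₀ this, le_div_iff₀ this]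

lemma cell_unique {n : ℕ} (hn : 1 ≤ n) {j k : ℕ} {y : ℝ} (hj : y ∈ cell n j)
    (hk : y ∈ cell n k) : j = k := by
  rw [mem_cell_iff hn] at hj hk
  have h1 : (j : ℝ) < k + 1 := by linarith
  have h2 : (k : ℝ) < j + 1 := by linarith
  norm_cast at h1 h2
  omega

lemma exists_mem_cell {n : ℕ} (hn : 1 ≤ n) {y : ℝ} (hy : y ∈ Ioc (0 : ℝ) 1) :
    ∃ j < n, y ∈ cell n j := by
  have hn' : (0 : ℝ) < n := by exact_mod_cast hn
  have h0 : 0 < y * n := mul_pos hy.1 hn'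
  have hc : 0 < ⌈y * n⌉₊ := Nat.ceil_pos.2 h0
  have hle : ⌈y * n⌉₊ ≤ n := Nat.ceil_le.2 (by nlinarith [hy.2])
  obtain ⟨j, hj⟩ := Nat.exists_eq_succ_of_ne_zero hc.ne'
  refine ⟨j, by omega, (mem_cell_iff hn).2 ⟨?_, ?_⟩⟩
  · exact Nat.lt_ceil.1 (by omega)
  · have := Nat.le_ceil (y * n)
    rw [hj] at this
    exact_mod_cast this

lemma cell_subset {n : ℕ} (hn : 1 ≤ n) {j : ℕ} (hj : j < n) : cell n j ⊆ Ioc (0 : ℝ) 1 := by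
  intro y hy
  have hn' : (0 : ℝ) < n := by exact_mod_cast hn
  rw [mem_cell_iff hn] at hy
  have hj' : (j : ℝ) + 1 ≤ n := by exact_mod_cast hj
  have : (0 : ℝ) ≤ j := by positivity
  refine ⟨?_, ?_⟩
  · by_contra! h
    nlinarith [hy.1]
  · by_contra! h
    nlinarith [hy.2]

lemma cellAverage_toFun {φ : ℝ → ℝ} {n : ℕ} (hn : 1 ≤ n) {j : ℕ} (hj : j < n) {y : ℝ}
    (hy : y ∈ cell n j) :
    (cellAverage φ hn).toFun y = n * ∫ t in ((j : ℝ) / n)..(((j : ℝ) + 1) / n), φ t := by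
  rw [StepFn.toFun, Finset.sum_eq_single j]
  · refine indicator_of_mem ?_ _
    simpa [cellAverage, cell] using hy
  · intro k _ hk
    refine indicator_of_notMem (fun h => hk ?_) _
    refine (cell_unique hn hy ?_).symm
    simpa [cellAverage, cell] using h
  · intro h
    exact absurd (Finset.mem_range.2 hj) h

lemma abs_sub_cellAverage_le {φ : ℝ → ℝ} (hφ : Continuous φ)
    (hL : ∀ y ∈ Icc (0 : ℝ) 1, ∀ z ∈ Icc (0 : ℝ) 1, |φ y - φ z| ≤ |y - z|)
    {n : ℕ} (hn : 1 ≤ n) {y : ℝ} (hy : y ∈ Ioc (0 : ℝ) 1) :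
    |φ y - (cellAverage φ hn).toFun y| ≤ 1 / n := by
  obtain ⟨j, hj, hyj⟩ := exists_mem_cell hn hy
  have hn' : (0 : ℝ) < n := by exact_mod_cast hn
  rw [cellAverage_toFun hn hj hyj]
  have hlen : ((j : ℝ) + 1) / n - j / n = 1 / n := by ring
  have e : φ y - n * ∫ t in ((j : ℝ) / n)..(((j : ℝ) + 1) / n), φ t =
      n * ∫ t in ((j : ℝ) / n)..(((j : ℝ) + 1) / n), (φ y - φ t) := by
    rw [intervalIntegral.integral_sub (by simp) (hφ.intervalIntegrable _ _),
      intervalIntegral.integral_const, hlen, smul_eq_mul]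
    field_simp
  have hb : ‖∫ t in ((j : ℝ) / n)..(((j : ℝ) + 1) / n), (φ y - φ t)‖ ≤
      1 / n * |((j : ℝ) + 1) / n - j / n| := by
    refine intervalIntegral.norm_integral_le_of_norm_le_const fun t ht => ?_
    rw [uIoc_of_le (by linarith [show (0 : ℝ) < 1 / n by positivity])] at ht
    have ht1 := cell_subset hn hj ht
    refine (hL y (Ioc_subset_Icc_self hy) t (Ioc_subset_Icc_self ht1)).trans ?_
    rw [abs_le]
    constructor <;> linarith [hyj.1, hyj.2, ht.1, ht.2]
  rw [hlen, abs_of_pos (by positivity), Real.norm_eq_abs] at hb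
  rw [e, abs_mul, abs_of_pos hn']
  calc _ ≤ (n : ℝ) * (1 / n * (1 / n)) := by gcongr
    _ = 1 / n := by field_simp

/-- Only the cell of `y` matters in the sum. If `z` shares it, the averages cancel and the Lipschitz
bound remains; otherwise each point contributes an error of at most `1 / n`. The value `z = 0`,
which lies in no cell, is included to cover the boundary part of the energy. -/
lemma sq_diffFn_sub_cellAverage_le {φ : ℝ → ℝ} (hφ : Continuous φ) (hφ0 : φ 0 = 0)
    (hL : ∀ y ∈ Icc (0 : ℝ) 1, ∀ z ∈ Icc (0 : ℝ) 1, |φ y - φ z| ≤ |y - z|)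
    {n : ℕ} (hn : 1 ≤ n) {y z : ℝ} (hy : y ∈ Ioo (0 : ℝ) 1) (hz : z ∈ Ico (0 : ℝ) 1) :
    ((diffFn φ - diffFn (cellAverage φ hn).toFun) (y, z)) ^ 2 ≤
      ∑ j ∈ Finset.range n, ((cell n j).indicator (fun _ => 1) y *
        (cell n j).indicator (fun _ => 1) z * (y - z) ^ 2 + 4 * (1 / n) ^ 2 *
        ((cell n j).indicator (fun _ => 1) y - (cell n j).indicator (fun _ => 1) z) ^ 2) := by
  obtain ⟨j, hj, hyj⟩ := exists_mem_cell hn (Ioo_subset_Ioc_self hy)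
  have hind : ∀ (j : ℕ) (x : ℝ), 0 ≤ (cell n j).indicator (fun _ => (1 : ℝ)) x := fun j x =>
    indicator_nonneg (fun _ _ => zero_le_one) x
  refine le_trans ?_ (Finset.single_le_sum (fun k _ => ?_) (Finset.mem_range.2 hj))
  · by_cases hzj : z ∈ cell n j
    · have e : (diffFn φ - diffFn (cellAverage φ hn).toFun) (y, z) = φ y - φ z := by
        simp only [Pi.sub_apply, diffFn, cellAverage_toFun hn hj hyj, cellAverage_toFun hn hj hzj]
        ring
      rw [e, indicator_of_mem hyj, indicator_of_mem hzj, ← sq_abs, ← sq_abs (y - z)]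
      have := pow_le_pow_left₀ (abs_nonneg _)
        (hL y (Ioo_subset_Icc_self hy) z (Ico_subset_Icc_self hz)) 2
      simpa using this
    · rw [indicator_of_mem hyj, indicator_of_notMem hzj]
      have h1 := abs_sub_cellAverage_le hφ hL hn (Ioo_subset_Ioc_self hy)
      have h2 : |φ z - (cellAverage φ hn).toFun z| ≤ 1 / n := by
        rcases hz.1.eq_or_lt with h | h
        · rw [← h, hφ0, StepFn.toFun_zero]
          simp
        · exact abs_sub_cellAverage_le hφ hL hn ⟨h, hz.2.le⟩
      have e : (diffFn φ - diffFn (cellAverage φ hn).toFun) (y, z) =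
          (φ y - (cellAverage φ hn).toFun y) - (φ z - (cellAverage φ hn).toFun z) := by
        simp only [Pi.sub_apply, diffFn]
        ring
      rw [e, ← sq_abs]
      have := pow_le_pow_left₀ (abs_nonneg _) ((abs_sub _ _).trans (add_le_add h1 h2)) 2
      linarith
  · have := hind k y
    have := hind k z
    positivity

lemma lintegral_cell_volD_le {n : ℕ} (j : ℕ) :
    ∫⁻ y, (cell n j).indicator 1 y ∂volD ≤ ENNReal.ofReal (1 / n) := by
  have hc : MeasurableSet (cell n j) := measurableSet_Ioc
  rw [lintegral_indicator_one hc]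
  refine (Measure.restrict_le_self _).trans (le_of_eq ?_)
  rw [cell, Real.volume_Ioc]
  congr 1
  ring

/-- The square absorbs the singularity on the diagonal and leaves `|y - z|^(2H)`, with a constant at
most `1`. -/
lemma jumpKernel_mul_sq_le {H : ℝ} (hH0 : 0 < H) (hH : H ≤ 1 / 2) {y z h : ℝ}
    (hyz : |y - z| ≤ h) :
    jumpKernel H y z * ENNReal.ofReal ((y - z) ^ 2) ≤ ENNReal.ofReal (h ^ (2 * H)) := by
  have hc : 0 ≤ H * (1 - 2 * H) / 2 := by nlinarith
  rw [jumpKernel, ← ENNReal.ofReal_mul (mul_nonneg hc (Real.rpow_nonneg (abs_nonneg _) _))]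
  refine ENNReal.ofReal_le_ofReal ?_
  rcases (abs_nonneg (y - z)).eq_or_lt with h0 | h0
  · rw [← sq_abs (y - z), ← h0]
    simpa using Real.rpow_nonneg ((abs_nonneg _).trans hyz) _
  · have e : |y - z| ^ (2 * H - 2) * (y - z) ^ 2 = |y - z| ^ (2 * H) := by
      rw [← sq_abs (y - z), ← Real.rpow_natCast, ← Real.rpow_add h0]
      congr 1
      norm_num
    rw [mul_assoc, e]
    have h1 : |y - z| ^ (2 * H) ≤ h ^ (2 * H) :=
      Real.rpow_le_rpow h0.le hyz (by linarith)
    exact (mul_le_of_le_one_left (Real.rpow_nonneg h0.le (2 * H)) (by nlinarith)).trans h1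

lemma lintegral_cell_sq_energyMeasure_le {H : ℝ} (hH0 : 0 < H) (hH : H ≤ 1 / 2) {n : ℕ} (j : ℕ) :
    ∫⁻ p, ENNReal.ofReal ((cell n j).indicator (fun _ => 1) p.1 *
        (cell n j).indicator (fun _ => 1) p.2 * (p.1 - p.2) ^ 2) ∂energyMeasure H ≤
      ENNReal.ofReal ((1 / n) ^ (2 * H)) * (ENNReal.ofReal (1 / n) * ENNReal.ofReal (1 / n)) := by
  have hcm : MeasurableSet (cell n j) := measurableSet_Ioc
  have hm : Measurable ((cell n j).indicator (fun _ => (1 : ℝ))) := measurable_const.indicator hcm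
  have h0 : (0 : ℝ) ∉ cell n j := fun h => absurd h.1 (not_lt.2 (by positivity))
  rw [lintegral_energyMeasure H (by fun_prop)]
  -- The boundary part vanishes, since its second coordinate `0` lies in no cell.
  simp only [indicator_of_notMem h0, mul_zero, zero_mul, ENNReal.ofReal_zero, lintegral_zero,
    add_zero]
  have hpt : ∀ y z, jumpKernel H y z * ENNReal.ofReal ((cell n j).indicator (fun _ => 1) y *
        (cell n j).indicator (fun _ => 1) z * (y - z) ^ 2) ≤
      (ENNReal.ofReal ((1 / n) ^ (2 * H)) * (cell n j).indicator 1 y) *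
        (cell n j).indicator 1 z := by
    intro y z
    by_cases hy : y ∈ cell n j <;> by_cases hz : z ∈ cell n j <;> simp only [hy, hz,
      indicator_of_mem, indicator_of_notMem, not_false_eq_true, mul_zero, zero_mul, one_mul,
      ENNReal.ofReal_zero, le_refl, Pi.one_apply, mul_one]
    refine jumpKernel_mul_sq_le hH0 hH ?_
    have e : ((j : ℝ) + 1) / n - j / n = 1 / n := by ring
    rw [abs_le]
    constructor <;> linarith [hy.1, hy.2, hz.1, hz.2]
  have hm1 : Measurable ((cell n j).indicator (1 : ℝ → ℝ≥0∞)) := measurable_one.indicator hcm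
  calc _ ≤ ∫⁻ y, ∫⁻ z, (ENNReal.ofReal ((1 / n) ^ (2 * H)) * (cell n j).indicator 1 y) *
        (cell n j).indicator 1 z ∂volD ∂volD :=
        lintegral_mono fun y => lintegral_mono fun z => hpt y z
    _ = ENNReal.ofReal ((1 / n) ^ (2 * H)) * ((∫⁻ y, (cell n j).indicator 1 y ∂volD) *
        ∫⁻ y, (cell n j).indicator 1 y ∂volD) := by
        simp_rw [lintegral_const_mul _ hm1]
        rw [lintegral_mul_const _ (hm1.const_mul _), lintegral_const_mul _ hm1, mul_assoc]
    _ ≤ _ := by gcongr <;> exact lintegral_cell_volD_le j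

/-- The energy distance of a Lipschitz function to its cell averages. -/
lemma eLpNorm_sub_cellAverage_sq_le {H : ℝ} (hH0 : 0 < H) (hH : H ≤ 1 / 2) {φ : ℝ → ℝ}
    (hφ : Continuous φ) (hφ0 : φ 0 = 0)
    (hL : ∀ y ∈ Icc (0 : ℝ) 1, ∀ z ∈ Icc (0 : ℝ) 1, |φ y - φ z| ≤ |y - z|)
    {n : ℕ} (hn : 1 ≤ n) :
    eLpNorm (diffFn φ - diffFn (cellAverage φ hn).toFun) 2 (energyMeasure H) ^ 2 ≤
      ENNReal.ofReal (5 * (1 / n) ^ (2 * H + 1)) := by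
  have hn' : (0 : ℝ) < n := by exact_mod_cast hn
  have hcm : ∀ j, Measurable ((cell n j).indicator (fun _ => (1 : ℝ))) := fun j =>
    measurable_const.indicator measurableSet_Ioc
  rw [eLpNorm_two_sq]
  have hvol : ∀ᵐ x ∂volD, x ∈ Ioo (0 : ℝ) 1 := ae_restrict_mem measurableSet_Ioo
  have hind : ∀ (j : ℕ) (x : ℝ), 0 ≤ (cell n j).indicator (fun _ => (1 : ℝ)) x := fun j x =>
    indicator_nonneg (fun _ _ => zero_le_one) x
  have hae : ∀ᵐ q ∂energyMeasure H, q.1 ∈ Ico (0 : ℝ) 1 ∧ q.2 ∈ Ico (0 : ℝ) 1 :=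
    ae_energyMeasure (hvol.mono fun x hx => Ioo_subset_Ico_self hx) (by simp)
  have hle : ∀ᵐ q ∂energyMeasure H,
      ENNReal.ofReal (((diffFn φ - diffFn (cellAverage φ hn).toFun) q) ^ 2) ≤
      ∑ j ∈ Finset.range n, (ENNReal.ofReal ((cell n j).indicator (fun _ => 1) q.1 *
        (cell n j).indicator (fun _ => 1) q.2 * (q.1 - q.2) ^ 2) +
        ENNReal.ofReal (4 * (1 / n) ^ 2) * ENNReal.ofReal (((cell n j).indicator (fun _ => 1) q.1 -
          (cell n j).indicator (fun _ => 1) q.2) ^ 2)) := by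
    filter_upwards [hae] with q hq
    have h1 : ∀ j ∈ Finset.range n, 0 ≤ (cell n j).indicator (fun _ => (1 : ℝ)) q.1 *
        (cell n j).indicator (fun _ => (1 : ℝ)) q.2 * (q.1 - q.2) ^ 2 := fun j _ =>
      mul_nonneg (mul_nonneg (hind _ _) (hind _ _)) (sq_nonneg _)
    have h2 : ∀ j ∈ Finset.range n, ENNReal.ofReal ((cell n j).indicator (fun _ => 1) q.1 *
        (cell n j).indicator (fun _ => 1) q.2 * (q.1 - q.2) ^ 2) +
        ENNReal.ofReal (4 * (1 / n) ^ 2) * ENNReal.ofReal (((cell n j).indicator (fun _ => 1) q.1 -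
          (cell n j).indicator (fun _ => 1) q.2) ^ 2) =
        ENNReal.ofReal ((cell n j).indicator (fun _ => 1) q.1 *
        (cell n j).indicator (fun _ => 1) q.2 * (q.1 - q.2) ^ 2 + 4 * (1 / n) ^ 2 *
        ((cell n j).indicator (fun _ => 1) q.1 - (cell n j).indicator (fun _ => 1) q.2) ^ 2) := by
      intro j hj
      rw [ENNReal.ofReal_add (h1 j hj) (by positivity),
        ENNReal.ofReal_mul (p := 4 * (1 / (n : ℝ)) ^ 2) (by positivity)]
    rw [Finset.sum_congr rfl h2, ← ENNReal.ofReal_sum_of_nonneg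
      (fun j hj => add_nonneg (h1 j hj) (by positivity))]
    refine ENNReal.ofReal_le_ofReal ?_
    -- The almost everywhere statement allows either coordinate to be `0`. If only the first one is,
    -- both sides are symmetric and the coordinates are exchanged.
    rcases hq.1.1.eq_or_lt with h0 | h0
    · rcases hq.2.1.eq_or_lt with h0' | h0'
      · have : (diffFn φ - diffFn (cellAverage φ hn).toFun) q = 0 := by
          simp [diffFn, ← h0, ← h0']
        rw [this]
        exact (by norm_num : (0 : ℝ) ^ 2 ≤ 0).trans (Finset.sum_nonneg fun j hj =>
          add_nonneg (h1 j hj) (by positivity))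
      · have := sq_diffFn_sub_cellAverage_le hφ hφ0 hL hn ⟨h0', hq.2.2⟩ hq.1
        convert this using 1
        · simp only [Pi.sub_apply, diffFn]; ring
        · refine Finset.sum_congr rfl fun j _ => ?_
          ring
    · exact sq_diffFn_sub_cellAverage_le hφ hφ0 hL hn ⟨h0, hq.1.2⟩ hq.2
  refine (lintegral_mono_ae hle).trans ?_
  have m1 : ∀ j, Measurable (fun q : ℝ × ℝ => ENNReal.ofReal ((cell n j).indicator (fun _ => 1) q.1 *
        (cell n j).indicator (fun _ => 1) q.2 * (q.1 - q.2) ^ 2)) := fun j => by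
    have := hcm j
    fun_prop
  have m2 : ∀ j, Measurable (fun q : ℝ × ℝ =>
      ENNReal.ofReal (((cell n j).indicator (fun _ => (1 : ℝ)) q.1 -
          (cell n j).indicator (fun _ => 1) q.2) ^ 2)) := fun j => by
    have := hcm j
    fun_prop
  rw [lintegral_finsetSum _ fun j _ => by have := hcm j; fun_prop]
  -- With `h = 1 / n`, each cell contributes `h^(2H) · h²` from pairs inside it and `4h² · h^(2H)`
  -- from pairs it separates. Summing over `n` cells loses one power of `h`.
  have hterm : ∀ j ∈ Finset.range n, ∫⁻ q, (ENNReal.ofReal ((cell n j).indicator (fun _ => 1) q.1 *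
        (cell n j).indicator (fun _ => 1) q.2 * (q.1 - q.2) ^ 2) +
        ENNReal.ofReal (4 * (1 / n) ^ 2) * ENNReal.ofReal (((cell n j).indicator (fun _ => 1) q.1 -
          (cell n j).indicator (fun _ => 1) q.2) ^ 2)) ∂energyMeasure H ≤
      ENNReal.ofReal (5 * (1 / n) ^ (2 * H + 1) * (1 / n)) := by
    intro j hj
    have hj' : (j : ℝ) + 1 ≤ n := by exact_mod_cast Finset.mem_range.1 hj
    have he := lintegral_indicator_energyMeasure hH0 hH (a := (j : ℝ) / n) (b := ((j : ℝ) + 1) / n)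
      (by positivity) (by gcongr; linarith) ((div_le_one hn').2 hj')
    rw [show ((j : ℝ) + 1) / n - j / n = 1 / n by ring] at he
    have he' : ∫⁻ q, ENNReal.ofReal (((cell n j).indicator (fun _ => (1 : ℝ)) q.1 -
          (cell n j).indicator (fun _ => 1) q.2) ^ 2) ∂energyMeasure H =
          ENNReal.ofReal ((1 / n) ^ (2 * H)) := he
    rw [lintegral_add_left (m1 j), lintegral_const_mul _ (m2 j), he']
    refine (add_le_add (lintegral_cell_sq_energyMeasure_le hH0 hH j) le_rfl).trans (le_of_eq ?_)
    have hp : (0 : ℝ) ≤ (1 / n) ^ (2 * H) := by positivity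
    rw [← ENNReal.ofReal_mul (by positivity), ← ENNReal.ofReal_mul hp,
      ← ENNReal.ofReal_mul (by positivity), ← ENNReal.ofReal_add (by positivity) (by positivity)]
    congr 1
    rw [Real.rpow_add (by positivity), Real.rpow_one]
    ring
  refine (Finset.sum_le_sum hterm).trans (le_of_eq ?_)
  rw [Finset.sum_const, Finset.card_range, nsmul_eq_mul, ← ENNReal.ofReal_natCast,
    ← ENNReal.ofReal_mul hn'.le]
  congr 1
  field_simp

/-! ### The Green's function and its solution operator -/

lemma continuous_green (x : ℝ) : Continuous (green x) := by
  unfold green; fun_prop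

lemma measurable_uncurry_green : Measurable (Function.uncurry green) := by
  unfold green Function.uncurry; fun_prop

lemma green_zero {x : ℝ} (hx : 0 ≤ x) : green x 0 = 0 := by simp [green, hx]

lemma green_comm (x y : ℝ) : green x y = green y x := by
  rw [green, green, min_comm, mul_comm]

lemma abs_green_sub_le {x : ℝ} (hx : x ∈ Icc (0 : ℝ) 1) (y z : ℝ) :
    |green x y - green x z| ≤ |y - z| := by
  wlog h : z ≤ y generalizing y z
  · rw [abs_sub_comm, abs_sub_comm y]
    exact this z y (not_le.1 h).le
  have h1 : min x z ≤ min x y := min_le_min_left x h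
  have h2 : min x y ≤ min x z + (y - z) := by
    rcases le_total x z with hz | hz
    · rw [min_eq_left hz, min_eq_left (hz.trans h)]; linarith
    · rw [min_eq_right hz]; linarith [min_le_right x y]
  have h3 : 0 ≤ x * (y - z) := mul_nonneg hx.1 (sub_nonneg.2 h)
  have h4 : 0 ≤ (1 - x) * (y - z) := mul_nonneg (sub_nonneg.2 hx.2) (sub_nonneg.2 h)
  rw [abs_of_nonneg (sub_nonneg.2 h), abs_le, green, green]
  constructor <;> nlinarith

lemma abs_green_le {x y : ℝ} (hx : x ∈ Icc (0 : ℝ) 1) (hy : y ∈ Icc (0 : ℝ) 1) :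
    |green x y| ≤ 1 := by
  have := abs_green_sub_le hx y 0
  rw [green_zero hx.1, sub_zero, sub_zero, abs_of_nonneg hy.1] at this
  exact this.trans hy.2

/-- The partial derivative `∂ₜ G(t, y)` of the Green's function. -/
noncomputable def greenDeriv (t y : ℝ) : ℝ := (Iic y).indicator (fun _ => 1) t - y

lemma measurable_uncurry_greenDeriv : Measurable (Function.uncurry greenDeriv) := by
  have hs : MeasurableSet {p : ℝ × ℝ | p.1 ≤ p.2} := measurableSet_le measurable_fst measurable_snd
  have : Function.uncurry greenDeriv =
      fun p => {p : ℝ × ℝ | p.1 ≤ p.2}.indicator (fun _ => (1 : ℝ)) p - p.2 := by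
    ext p; simp [Function.uncurry, greenDeriv, indicator]
  rw [this]
  exact (measurable_const.indicator hs).sub measurable_snd

lemma measurable_greenDeriv_left (y : ℝ) : Measurable fun t => greenDeriv t y :=
  measurable_uncurry_greenDeriv.of_uncurry_right

lemma abs_greenDeriv_le (t : ℝ) {y : ℝ} (hy : y ∈ Icc (0 : ℝ) 1) : |greenDeriv t y| ≤ 1 := by
  by_cases h : t ≤ y
  · rw [greenDeriv, indicator_of_mem (mem_Iic.2 h), abs_le]
    constructor <;> linarith [hy.1, hy.2]
  · rw [greenDeriv, indicator_of_notMem (show t ∉ Iic y from h), abs_le]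
    constructor <;> linarith [hy.1, hy.2]

lemma ae_mem_Ioo_volD : ∀ᵐ x ∂volD, x ∈ Ioo (0 : ℝ) 1 := ae_restrict_mem measurableSet_Ioo

lemma intervalIntegral_indicator_Iic {w : ℝ → ℝ} {x y : ℝ} (hx : 0 ≤ x) (hy : 0 ≤ y) :
    ∫ t in (0 : ℝ)..x, (Iic y).indicator w t = ∫ t in (0 : ℝ)..(min x y), w t := by
  rw [intervalIntegral.integral_of_le hx, intervalIntegral.integral_of_le (le_min hx hy),
    setIntegral_indicator measurableSet_Iic]
  congr 2
  ext t
  simp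

lemma integral_greenDeriv {x y : ℝ} (hx : 0 ≤ x) (hy : 0 ≤ y) :
    ∫ t in Ioc 0 x, greenDeriv t y = green x y := by
  rw [← intervalIntegral.integral_of_le hx]
  have hi : IntervalIntegrable ((Iic y).indicator fun _ => (1 : ℝ)) volume 0 x := by
    rw [intervalIntegrable_iff_integrableOn_Ioc_of_le hx]
    exact (integrable_const (1 : ℝ)).indicator measurableSet_Iic
  simp only [greenDeriv]
  rw [intervalIntegral.integral_sub hi (by simp),
    intervalIntegral_indicator_Iic hx hy]
  simp [green]

/-- The solution operator `F ↦ ∫ G(·, y) F(y) dy` of the homogeneous Dirichlet problem. -/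
noncomputable def greenOp (F : ℝ → ℝ) (x : ℝ) : ℝ := ∫ y, green x y * F y ∂volD

lemma integral_mul_integral_greenDeriv {μ : Measure ℝ} [IsFiniteMeasure μ] {a F : ℝ → ℝ}
    (ha : Integrable a μ) (hF : Integrable F volD) :
    ∫ t, a t * ∫ y, greenDeriv t y * F y ∂volD ∂μ =
      ∫ y, (∫ t, a t * greenDeriv t y ∂μ) * F y ∂volD := by
  have hint : Integrable (Function.uncurry fun t y => greenDeriv t y * (a t * F y))
      (μ.prod volD) := by
    refine Integrable.bdd_mul (c := 1) (ha.mul_prod hF)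
      measurable_uncurry_greenDeriv.aestronglyMeasurable ?_
    filter_upwards [Measure.quasiMeasurePreserving_snd.ae ae_mem_Ioo_volD] with p hp
    exact abs_greenDeriv_le _ (Ioo_subset_Icc_self hp)
  have h := integral_integral_swap hint
  simp_rw [← integral_const_mul, ← integral_mul_const]
  have e : ∀ t y, greenDeriv t y * (a t * F y) = a t * (greenDeriv t y * F y) := fun t y => by ring
  have e' : ∀ t y, a t * (greenDeriv t y * F y) = a t * greenDeriv t y * F y := fun t y => by ring
  simp_rw [e] at h
  rw [h]
  simp_rw [e']

/-- The reproducing property, the weak form of `-∂²G(·, y) = δ_y`: the indicator part gives the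
primitive of `w` at `y`, and the part `-y` contributes `-y v(1) = 0`. It yields both the energy
identity for `greenOp` and the integral equation for variational solutions. -/
lemma integral_mul_greenDeriv {v w : ℝ → ℝ} (h : IsH10 v w) {y : ℝ} (hy : y ∈ Icc (0 : ℝ) 1) :
    ∫ t, w t * greenDeriv t y ∂volD = v y := by
  have hw : Integrable w volD := h.memLp.integrable (by norm_num)
  have e : ∀ t, w t * greenDeriv t y = (Iic y).indicator w t - y * w t := by
    intro t
    by_cases ht : t ≤ y <;> simp [greenDeriv, indicator, ht] <;> ring
  simp_rw [e]
  rw [integral_sub (hw.indicator measurableSet_Iic) (hw.const_mul y), integral_const_mul,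
    integral_volD, integral_volD, intervalIntegral_indicator_Iic zero_le_one hy.1,
    min_eq_right hy.2, ← h.eq_primitive y hy, ← h.eq_primitive 1 (by simp), h.right]
  ring

lemma isH10_green {x : ℝ} (hx : x ∈ Icc (0 : ℝ) 1) :
    IsH10 (green x) (fun t => greenDeriv t x) := by
  refine ⟨?_, fun y hy => ?_, ?_⟩
  · exact MemLp.of_bound (measurable_greenDeriv_left x).aestronglyMeasurable 1
      (Eventually.of_forall fun t => abs_greenDeriv_le t hx)
  · rw [intervalIntegral.integral_of_le hy.1, integral_greenDeriv hy.1 hx.1, green_comm]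
  · simp [green, hx.2]

/-- `greenOp F` lies in `H¹₀`, and its energy is `(F, greenOp F)`. -/
lemma exists_isH10_greenOp {F : ℝ → ℝ} (hF : Integrable F volD) :
    ∃ w, IsH10 (greenOp F) w ∧ ∫ x, w x ^ 2 ∂volD = ∫ x, greenOp F x * F x ∂volD := by
  set w : ℝ → ℝ := fun t => ∫ y, greenDeriv t y * F y ∂volD with hw
  have hwm : AEStronglyMeasurable w volD := by
    refine AEStronglyMeasurable.integral_prod_right'
      (f := fun p : ℝ × ℝ => greenDeriv p.1 p.2 * F p.2) (μ := volD) (ν := volD) ?_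
    exact measurable_uncurry_greenDeriv.aestronglyMeasurable.mul hF.1.comp_snd
  have hwb : ∀ t, ‖w t‖ ≤ ∫ y, ‖F y‖ ∂volD := by
    intro t
    refine norm_integral_le_of_norm_le hF.norm ?_
    filter_upwards [ae_mem_Ioo_volD] with y hy
    rw [norm_mul]
    exact mul_le_of_le_one_left (norm_nonneg _) (abs_greenDeriv_le t (Ioo_subset_Icc_self hy))
  have hwL : MemLp w 2 volD := MemLp.of_bound hwm _ (Eventually.of_forall hwb)
  have hH : IsH10 (greenOp F) w := by
    refine ⟨hwL, fun x hx => ?_, ?_⟩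
    · rw [intervalIntegral.integral_of_le hx.1]
      have := integral_mul_integral_greenDeriv (μ := volume.restrict (Ioc 0 x)) (a := fun _ => 1)
        (integrable_const _) hF
      simp only [one_mul] at this
      rw [hw, this]
      refine integral_congr_ae ?_
      filter_upwards [ae_mem_Ioo_volD] with y hy
      rw [integral_greenDeriv hx.1 hy.1.le]
    · refine integral_eq_zero_of_ae ?_
      filter_upwards [ae_mem_Ioo_volD] with y hy
      simp [green, hy.2.le]
  refine ⟨w, hH, ?_⟩
  -- One factor `w` is expanded as an integral of `greenDeriv`; after Fubini the other is paired
  -- with `greenDeriv · y`, which reproduces `greenOp F y`.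
  have := integral_mul_integral_greenDeriv (hwL.integrable (by norm_num)) hF
  simp_rw [sq]
  refine this.trans (integral_congr_ae ?_)
  filter_upwards [ae_mem_Ioo_volD] with y hy
  rw [integral_mul_greenDeriv hH (Ioo_subset_Icc_self hy)]

lemma IsH10.continuousOn {v w : ℝ → ℝ} (h : IsH10 v w) : ContinuousOn v (Icc 0 1) := by
  have h1 : IntegrableOn w (Icc 0 1) volume := by
    rw [integrableOn_Icc_iff_integrableOn_Ioo]
    exact h.memLp.integrable (by norm_num)
  exact (intervalIntegral.continuousOn_primitive_interval
    (by rwa [uIcc_of_le zero_le_one])).congr (fun x hx => h.eq_primitive x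
      (by rwa [uIcc_of_le zero_le_one] at hx)) |>.mono (by rw [uIcc_of_le zero_le_one])

lemma IsH10.memLp_self {v w : ℝ → ℝ} (h : IsH10 v w) : MemLp v 2 volD := by
  obtain ⟨C, hC⟩ := isCompact_Icc.exists_bound_of_continuousOn h.continuousOn
  refine MemLp.of_bound ((h.continuousOn.mono Ioo_subset_Icc_self).aestronglyMeasurable
    measurableSet_Ioo) C ?_
  filter_upwards [ae_mem_Ioo_volD] with x hx using hC x (Ioo_subset_Icc_self hx)

/-! ### Deterministic stability: the energy estimate -/

/-- Any number below the Poincaré constant is an admissible constant. -/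
lemma exists_poincare {L : ℝ} (hL : L < poincareConst) :
    ∃ c, L < c ∧ ∀ v w : ℝ → ℝ, IsH10 v w → c * ∫ x, v x ^ 2 ∂volD ≤ ∫ x, w x ^ 2 ∂volD := by
  obtain ⟨c, hc, hLc⟩ := exists_lt_of_lt_csSup
    ⟨0, fun v w _ => by rw [zero_mul]; exact integral_nonneg fun x => sq_nonneg _⟩ hL
  exact ⟨c, hLc, hc⟩

lemma integrable_green_mul {F : ℝ → ℝ} (hF : Integrable F volD) {x : ℝ}
    (hx : x ∈ Icc (0 : ℝ) 1) : Integrable (fun y => green x y * F y) volD := by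
  refine Integrable.bdd_mul (c := 1) hF (continuous_green x).aestronglyMeasurable ?_
  filter_upwards [ae_mem_Ioo_volD] with y hy using abs_green_le hx (Ioo_subset_Icc_self hy)

lemma IsAdmissible.memLp_comp {L β : ℝ} {f : ℝ → ℝ → ℝ} (hf : IsAdmissible L β f) {v : ℝ → ℝ}
    (hv : MemLp v 2 volD) : MemLp (fun x => f x (v x)) 2 volD := by
  have hm : AEStronglyMeasurable (fun x => f x (v x)) volD :=
    by
    have h2 : AEMeasurable (fun x : ℝ => (x, v x)) volD := aemeasurable_id.prodMk hv.1.aemeasurable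
    exact (hf.measurable.comp_aemeasurable h2).aestronglyMeasurable
  have hg : MemLp (fun x => 1 + ‖v x‖) 2 volD := (memLp_const (1 : ℝ)).add hv.norm
  have hs : AEStronglyMeasurable (fun x => f x (v x) - f x 0) volD := hm.sub hf.zero_memLp.1
  have hd : MemLp (fun x => f x (v x) - f x 0) 2 volD := by
    refine hg.of_le_mul (c := β) hs ?_
    filter_upwards [ae_mem_Ioo_volD] with x hx
    have := hf.growth x hx (v x) 0
    rw [sub_zero] at this
    rwa [Real.norm_eq_abs, Real.norm_eq_abs, Real.norm_eq_abs,
      abs_of_nonneg (by positivity : 0 ≤ 1 + |v x|)]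
  have e : (fun x => f x (v x)) = (fun x => f x (v x) - f x 0) + fun x => f x 0 := by
    ext x; simp
  rw [e]
  exact hd.add hf.zero_memLp

lemma lintegral_ofReal_sq_eq {F : ℝ → ℝ} (hF : MemLp F 2 volD) :
    ∫⁻ x, ENNReal.ofReal (F x ^ 2) ∂volD = ENNReal.ofReal (∫ x, F x ^ 2 ∂volD) :=
  (ofReal_integral_eq_lintegral_ofReal hF.integrable_sq
    (Eventually.of_forall fun _ => sq_nonneg _)).symm

lemma lintegral_volD_const (c : ℝ≥0∞) : ∫⁻ _, c ∂volD = c := by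
  rw [volD, lintegral_const, Measure.restrict_apply_univ, Real.volume_Ioo]; simp

/-- The energy estimate: comparison of `e` with `e + greenOp F`. -/
lemma integral_sq_le_of_energy {L κ a b : ℝ} (hκ : 0 < κ)
    (hP : ∀ v w : ℝ → ℝ, IsH10 v w → (L + κ) * ∫ x, v x ^ 2 ∂volD ≤ ∫ x, w x ^ 2 ∂volD)
    {F e : ℝ → ℝ} (hF : MemLp F 2 volD) (he : MemLp e 2 volD)
    (hpt : ∀ᵐ x ∂volD, F x * greenOp F x ≤
      (L + κ / 2) * greenOp F x ^ 2 + a * (e x + greenOp F x) ^ 2 + b) :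
    MemLp (fun x => e x + greenOp F x) 2 volD ∧
    ∫ x, e x ^ 2 ∂volD ≤ 2 * (1 + 2 * a / κ) * ∫ x, (e x + greenOp F x) ^ 2 ∂volD +
      4 * b / κ := by
  obtain ⟨w, hw, hwF⟩ := exists_isH10_greenOp (hF.integrable (by norm_num))
  have hv : MemLp (greenOp F) 2 volD := hw.memLp_self
  have hE : MemLp (fun x => e x + greenOp F x) 2 volD := he.add hv
  refine ⟨hE, ?_⟩
  have hv2 := hv.integrable_sq
  have hE2 := hE.integrable_sq
  have hFv : Integrable (fun x => F x * greenOp F x) volD := hF.integrable_mul hv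
  have hsum : Integrable (fun x => (L + κ / 2) * greenOp F x ^ 2 +
      a * (e x + greenOp F x) ^ 2) volD := (hv2.const_mul _).add (hE2.const_mul _)
  have h1 : ∫ x, F x * greenOp F x ∂volD ≤ (L + κ / 2) * ∫ x, greenOp F x ^ 2 ∂volD +
      a * ∫ x, (e x + greenOp F x) ^ 2 ∂volD + b := by
    refine (integral_mono_ae hFv (hsum.add (integrable_const b)) hpt).trans (le_of_eq ?_)
    have hc : ∫ _, b ∂volD = b := by rw [integral_volD]; simp
    rw [← integral_const_mul, ← integral_const_mul, ← integral_add (hv2.const_mul _)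
      (hE2.const_mul _)]
    refine (integral_add hsum (integrable_const b)).trans ?_
    rw [hc]
  -- Coercivity: `(L + κ)‖v‖² ≤ ‖v'‖² = (F, v)` for `v = greenOp F`. Combined with `h1`, this leaves
  -- `κ/2 ‖v‖²` on the left.
  have h2 := hP _ _ hw
  simp_rw [hwF, mul_comm (greenOp F _) (F _)] at h2
  have h3 : ∫ x, e x ^ 2 ∂volD ≤ 2 * ∫ x, (e x + greenOp F x) ^ 2 ∂volD +
      2 * ∫ x, greenOp F x ^ 2 ∂volD := by
    rw [← integral_const_mul, ← integral_const_mul, ← integral_add (hE2.const_mul _)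
      (hv2.const_mul _)]
    refine integral_mono he.integrable_sq ((hE2.const_mul _).add (hv2.const_mul _)) fun x => ?_
    beta_reduce
    nlinarith [sq_nonneg (e x + 2 * greenOp F x)]
  have h4 : ∫ x, greenOp F x ^ 2 ∂volD ≤
      2 * a / κ * ∫ x, (e x + greenOp F x) ^ 2 ∂volD + 2 * b / κ := by
    have : κ * ∫ x, greenOp F x ^ 2 ∂volD ≤
        2 * a * ∫ x, (e x + greenOp F x) ^ 2 ∂volD + 2 * b := by linarith
    rw [mul_comm] at this
    calc _ ≤ (2 * a * ∫ x, (e x + greenOp F x) ^ 2 ∂volD + 2 * b) / κ := by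
          rwa [le_div_iff₀ hκ]
      _ = _ := by ring
  have e1 : 4 * b / κ = 2 * (2 * b / κ) := by ring
  rw [e1]
  nlinarith

/-- The pointwise bound behind the energy estimate, for a nonlinearity of linear growth. -/
lemma IsAdmissible.mul_le {L β κ δ : ℝ} {f : ℝ → ℝ → ℝ} (hf : IsAdmissible L β f) (hκ : 0 < κ)
    (hδ : 0 < δ) {x : ℝ} (hx : x ∈ Ioo (0 : ℝ) 1) (r s v : ℝ) :
    (f x r - f x s) * v ≤ (L + κ / 2) * v ^ 2 +
      (β / δ + (β ^ 2 / κ + β + 4 * L ^ 2 / κ + L)) * (r - s + v) ^ 2 + β * δ := by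
  have hβ := hf.β_pos
  have hL := hf.L_pos
  set E := r - s + v with hE
  have he : r - s = E - v := by rw [hE]; ring
  have hm := hf.monotone x hx r s
  have hg := hf.growth x hx r s
  rw [sq_abs] at hm
  rw [he] at hm hg
  set F := f x r - f x s
  -- Monotonicity applied to `r - s = E - v` gives `F v ≤ F E + L (E - v)²`, so `F` is multiplied
  -- only by the small quantity `E`.
  have h1 : F * v ≤ |F| * |E| + L * (E - v) ^ 2 := by
    have := le_abs_self (F * E)
    rw [abs_mul] at this
    nlinarith
  have h2 : |F| * |E| ≤ β * (1 + (|E| + |v|)) * |E| := by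
    refine mul_le_mul_of_nonneg_right (hg.trans ?_) (abs_nonneg _)
    have := abs_sub E v
    gcongr
  -- The growth bound does not vanish as `r - s → 0`, so a term linear in `|E|` appears; `δ` trades
  -- it against a constant and a large multiple of `E²`.
  have h3 : |E| ≤ δ + E ^ 2 / δ := by
    have h : E ^ 2 / δ * δ = |E| ^ 2 := by rw [sq_abs]; field_simp
    by_contra! hc
    have := mul_lt_mul_of_pos_right hc hδ
    nlinarith [sq_nonneg (|E| - δ / 2), sq_nonneg δ]
  -- Young's inequality here and in `h5`: each cross term may use `κ/4` of the available `κ/2`.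
  have h4 : β * (|v| * |E|) ≤ κ / 4 * v ^ 2 + β ^ 2 / κ * E ^ 2 := by
    have h : κ / 4 * v ^ 2 + β ^ 2 / κ * E ^ 2 - β * (|v| * |E|) =
        (κ / 2 * |v| - β * |E|) ^ 2 / κ := by
      rw [← sq_abs v, ← sq_abs E]; field_simp; ring
    have : 0 ≤ (κ / 2 * |v| - β * |E|) ^ 2 / κ := by positivity
    linarith
  have h5 : -(2 * L * E * v) ≤ κ / 4 * v ^ 2 + 4 * L ^ 2 / κ * E ^ 2 := by
    have h : κ / 4 * v ^ 2 + 4 * L ^ 2 / κ * E ^ 2 + 2 * L * E * v =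
        (κ / 2 * v + 2 * L * E) ^ 2 / κ := by
      field_simp; ring
    have : 0 ≤ (κ / 2 * v + 2 * L * E) ^ 2 / κ := by positivity
    linarith
  have h6 : β * |E| ≤ β * δ + β / δ * E ^ 2 := by
    have := mul_le_mul_of_nonneg_left h3 hβ.le
    calc _ ≤ _ := this
      _ = _ := by ring
  have h7 : β * (1 + (|E| + |v|)) * |E| = β * |E| + β * E ^ 2 + β * (|v| * |E|) := by
    rw [← sq_abs E]; ring
  have h8 : L * (E - v) ^ 2 = L * v ^ 2 + -(2 * L * E * v) + L * E ^ 2 := by ring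
  nlinarith

/-- The pointwise bound behind the energy estimate, for a Lipschitz nonlinearity. -/
lemma mul_le_of_lipschitz {L κ : ℝ} (hL : 0 < L) (hκ : 0 < κ) {F r s : ℝ}
    (hF : |F| ≤ L * |r - s|) (v : ℝ) :
    F * v ≤ (L + κ / 2) * v ^ 2 + L ^ 2 / (2 * κ) * (r - s + v) ^ 2 + 0 := by
  set E := r - s + v with hE
  have he : r - s = E - v := by rw [hE]; ring
  rw [he] at hF
  have h1 : F * v ≤ L * (|E| + |v|) * |v| := by
    refine (le_abs_self _).trans ?_
    rw [abs_mul]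
    refine mul_le_mul_of_nonneg_right (hF.trans ?_) (abs_nonneg _)
    have := abs_sub E v
    gcongr
  have h : κ / 2 * v ^ 2 + L ^ 2 / (2 * κ) * E ^ 2 - L * |E| * |v| =
      (κ * |v| - L * |E|) ^ 2 / (2 * κ) := by
    rw [← sq_abs v, ← sq_abs E]; field_simp; ring
  have : 0 ≤ (κ * |v| - L * |E|) ^ 2 / (2 * κ) := by positivity
  have h8 : L * (|E| + |v|) * |v| = L * |E| * |v| + L * v ^ 2 := by rw [← sq_abs v]; ring
  linarith

/-! ### From the noise error to the mean-square error -/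

section Stochastic

variable {Ω : Type*}

lemma measurable_noiseApprox (W : ℝ → Ω → ℝ) (n : ℕ) (ω : Ω) :
    Measurable fun x => noiseApprox W n x ω := by
  unfold noiseApprox
  exact Finset.measurable_sum _ fun j _ => measurable_const.indicator measurableSet_Ioc

lemma memLp_noiseApprox (W : ℝ → Ω → ℝ) (n : ℕ) (ω : Ω) :
    MemLp (fun x => noiseApprox W n x ω) 2 volD := by
  refine MemLp.of_bound (measurable_noiseApprox W n ω).aestronglyMeasurable
    (∑ i ∈ Finset.range n, |(n : ℝ) * (W (((i : ℝ) + 1) / n) ω - W ((i : ℝ) / n) ω)|)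
    (Eventually.of_forall fun x => ?_)
  refine (Finset.abs_sum_le_sum_abs _ _).trans (Finset.sum_le_sum fun i _ => ?_)
  by_cases h : x ∈ Ioc ((i : ℝ) / n) (((i : ℝ) + 1) / n)
  · rw [indicator_of_mem h]
  · rw [indicator_of_notMem h, abs_zero]
    exact abs_nonneg _

/-- Testing the approximate noise amounts to integrating the cell averages. -/
lemma integral_noiseApprox_mul (W : ℝ → Ω → ℝ) {n : ℕ} (hn : 1 ≤ n) (ω : Ω) {φ : ℝ → ℝ}
    (hφ : Continuous φ) :
    ∫ y, noiseApprox W n y ω * φ y ∂volD = (cellAverage φ hn).integral W ω := by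
  have hn' : (0 : ℝ) < n := by exact_mod_cast hn
  have hφi : Integrable φ volD := by
    have := hφ.intervalIntegrable (μ := volume) 0 1
    rwa [intervalIntegrable_iff_integrableOn_Ioo_of_le zero_le_one] at this
  have e : ∀ y, noiseApprox W n y ω * φ y = ∑ i ∈ Finset.range n, (cell n i).indicator
      (fun y => ((n : ℝ) * (W (((i : ℝ) + 1) / n) ω - W ((i : ℝ) / n) ω)) * φ y) y := by
    intro y
    rw [noiseApprox, Finset.sum_mul]
    refine Finset.sum_congr rfl fun i _ => ?_
    by_cases h : y ∈ cell n i
    · rw [indicator_of_mem h]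
      rw [cell] at h
      rw [indicator_of_mem h]
    · rw [indicator_of_notMem h]
      rw [cell] at h
      rw [indicator_of_notMem h, zero_mul]
  have hmc : ∀ i, MeasurableSet (cell n i) := fun i => measurableSet_Ioc
  simp_rw [e]
  rw [integral_finsetSum _ fun i _ => (hφi.const_mul _).indicator (hmc i), StepFn.integral]
  refine Finset.sum_congr rfl fun i hi => ?_
  have hm : MeasurableSet (cell n i) := measurableSet_Ioc
  have hle : (i : ℝ) / n ≤ ((i : ℝ) + 1) / n := by gcongr; linarith
  rw [integral_indicator hm, integral_const_mul, volD_eq_Ioc, Measure.restrict_restrict hm,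
    inter_eq_left.2 (cell_subset hn (Finset.mem_range.1 hi)), cell,
    ← intervalIntegral.integral_of_le hle]
  simp only [cellAverage, Nat.cast_add, Nat.cast_one]
  ring

variable [MeasurableSpace Ω]

/-- The mean square error of the approximation of `∫ G(x, ·) dW`. -/
lemma IsWienerIntegral.lintegral_sq_sub_le {P : Measure Ω} {H : ℝ}
    (hH0 : 0 < H) (hH : H ≤ 1 / 2) {W : ℝ → Ω → ℝ} (hW : IsFBM P H W) {x : ℝ}
    (hx : x ∈ Icc (0 : ℝ) 1) {X : Ω → ℝ} (hX : IsWienerIntegral P W (green x) X)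
    {n : ℕ} (hn : 1 ≤ n) :
    ∫⁻ ω, ENNReal.ofReal ((X ω - (cellAverage (green x) hn).integral W ω) ^ 2) ∂P ≤
      ENNReal.ofReal (5 * (1 / n) ^ (2 * H + 1)) := by
  have h1 := hX.eLpNorm_sub_le hH0 hH hW (continuous_green x).measurable (green_zero hx.1)
    (cellAverage (green x) hn)
  have h2 := eLpNorm_sub_cellAverage_sq_le hH0 hH (continuous_green x) (green_zero hx.1)
    (fun y _ z _ => abs_green_sub_le hx y z) hn
  have h3 := eLpNorm_two_sq P (X - (cellAverage (green x) hn).integral W)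
  simp only [Pi.sub_apply] at h3
  rw [← h3]
  exact (pow_le_pow_left' h1 2).trans h2

/-- A variational solution satisfies the integral equation. -/
lemma IsApproxSolution.integral_eq {P : Measure Ω} {W : ℝ → Ω → ℝ} {f : ℝ → ℝ → ℝ}
    {g : ℝ → ℝ} (hg : MemLp g 2 volD) {n : ℕ} (hn : 1 ≤ n)
    {un : ℝ → Ω → ℝ} (h : IsApproxSolution P W f g n un) :
    ∀ᵐ ω ∂P, MemLp (fun x => un x ω) 2 volD ∧ ∀ x ∈ Ioo (0 : ℝ) 1,
      un x ω + greenOp (fun y => f y (un y ω)) x =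
        ∫ y, green x y * g y ∂volD + (cellAverage (green x) hn).integral W ω := by
  filter_upwards [h.variational] with ω hω
  obtain ⟨w, hw, hv⟩ := hω
  refine ⟨hw.memLp_self, fun x hx => ?_⟩
  have hx' := Ioo_subset_Icc_self hx
  -- Testing the variational equation with `green x` and using the reproducing property gives the
  -- integral equation at `x`.
  have h1 := hv _ _ (isH10_green hx')
  rw [integral_mul_greenDeriv hw hx'] at h1
  have hgi := integrable_green_mul (hg.integrable (by norm_num)) hx'
  have hni := integrable_green_mul ((memLp_noiseApprox W n ω).integrable (by norm_num)) hx'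
  have e : ∀ y, (g y + noiseApprox W n y ω) * green x y =
      green x y * g y + green x y * noiseApprox W n y ω := fun y => by ring
  simp_rw [e] at h1
  rw [integral_add hgi hni] at h1
  simp_rw [mul_comm (green x _) (noiseApprox W n _ ω)] at h1
  rw [integral_noiseApprox_mul W hn ω (continuous_green x)] at h1
  simp_rw [mul_comm _ (green x _)] at h1
  exact h1

lemma ae_ae_swap {P : Measure Ω} [IsProbabilityMeasure P] {p : ℝ × Ω → Prop}
    (h : ∀ᵐ q ∂volD.prod P, p q) : ∀ᵐ ω ∂P, ∀ᵐ x ∂volD, p (x, ω) := by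
  have hs : ∀ᵐ q ∂P.prod volD, p q.swap :=
    (Measure.measurePreserving_swap (μ := P) (ν := volD)).quasiMeasurePreserving.ae h
  exact Measure.ae_ae_of_ae_prod hs

lemma measurable_greenOp_comp {f : ℝ → ℝ → ℝ} (hf : Measurable (Function.uncurry f))
    {u v : ℝ × Ω → ℝ} (hu : Measurable u) (hv : Measurable v) :
    Measurable fun p : ℝ × Ω => greenOp (fun y => f y (u (y, p.2)) - f y (v (y, p.2))) p.1 := by
  have h1 : Measurable fun q : (ℝ × Ω) × ℝ => (q.2, q.1.2) := by fun_prop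
  have h2 : ∀ {u : ℝ × Ω → ℝ}, Measurable u →
      Measurable fun q : (ℝ × Ω) × ℝ => f q.2 (u (q.2, q.1.2)) := fun {u} hu => by
    have h3 : Measurable fun q : (ℝ × Ω) × ℝ => (q.2, u (q.2, q.1.2)) :=
      measurable_snd.prodMk (hu.comp h1)
    exact hf.comp h3
  have h4 : Measurable fun q : (ℝ × Ω) × ℝ => green q.1.1 q.2 := by
    have : Measurable fun q : (ℝ × Ω) × ℝ => (q.1.1, q.2) := by fun_prop
    exact measurable_uncurry_green.comp this
  have h5 : Measurable fun q : (ℝ × Ω) × ℝ =>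
      green q.1.1 q.2 * (f q.2 (u (q.2, q.1.2)) - f q.2 (v (q.2, q.1.2))) :=
    h4.mul ((h2 hu).sub (h2 hv))
  exact (StronglyMeasurable.integral_prod_right' (ν := volD) h5.stronglyMeasurable).measurable

/-- The error estimate obtained from a pointwise bound on the nonlinearity. -/
lemma msError_le_of_pointwise {P : Measure Ω} [IsProbabilityMeasure P] {H : ℝ} (hH0 : 0 < H)
    (hH : H ≤ 1 / 2) {W : ℝ → Ω → ℝ} (hW : IsFBM P H W) {L β : ℝ} {f : ℝ → ℝ → ℝ}
    (hf : IsAdmissible L β f) {g : ℝ → ℝ} (hg : MemLp g 2 volD) {κ a b : ℝ} (hκ : 0 < κ)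
    (ha : 0 ≤ a) (hb : 0 ≤ b)
    (hP : ∀ v w : ℝ → ℝ, IsH10 v w → (L + κ) * ∫ x, v x ^ 2 ∂volD ≤ ∫ x, w x ^ 2 ∂volD)
    (hpt : ∀ x ∈ Ioo (0 : ℝ) 1, ∀ r s v : ℝ, (f x r - f x s) * v ≤
      (L + κ / 2) * v ^ 2 + a * (r - s + v) ^ 2 + b)
    {u : ℝ → Ω → ℝ} (hu : IsMildSolution P W f g u) {n : ℕ} (hn : 1 ≤ n) {un : ℝ → Ω → ℝ}
    (hun : IsApproxSolution P W f g n un) :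
    msError P u un ≤ (ENNReal.ofReal (2 * (1 + 2 * a / κ) * (5 * (1 / n) ^ (2 * H + 1)) +
      4 * b / κ)) ^ (1 / 2 : ℝ) := by
  have hunI := hun.integral_eq hg hn
  -- The exchange of expectation and space integral needs a jointly measurable integrand, so the
  -- defect `E` is built from measurable versions of the solutions.
  set u' := hu.aemeasurable.mk
  set v' := hun.aemeasurable.mk
  have hum : Measurable u' := hu.aemeasurable.measurable_mk
  have hvm : Measurable v' := hun.aemeasurable.measurable_mk
  have hue : ∀ᵐ q ∂volD.prod P, u q.1 q.2 = u' q := hu.aemeasurable.ae_eq_mk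
  have hve : ∀ᵐ q ∂volD.prod P, un q.1 q.2 = v' q := hun.aemeasurable.ae_eq_mk
  set E : ℝ → Ω → ℝ := fun x ω => u' (x, ω) - v' (x, ω) +
    greenOp (fun y => f y (u' (y, ω)) - f y (v' (y, ω))) x with hE
  have hEm : Measurable (Function.uncurry E) :=
    (hum.sub hvm).add (measurable_greenOp_comp hf.measurable hum hvm)
  have hgreen : ∀ᵐ ω ∂P, ∀ x, greenOp (fun y => f y (u' (y, ω)) - f y (v' (y, ω))) x =
      greenOp (fun y => f y (u y ω) - f y (un y ω)) x := by
    filter_upwards [ae_ae_swap hue, ae_ae_swap hve] with ω h1 h2 x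
    refine integral_congr_ae ?_
    filter_upwards [h1, h2] with y h1 h2
    rw [h1, h2]
  -- Subtracting the mild and integral equations cancels `g` and the nonlinear terms, so `E x` is
  -- almost surely the Wiener integral of `green x` minus the elementary integral of its cell
  -- averages.
  have hmean : ∀ᵐ x ∂volD, ∫⁻ ω, ENNReal.ofReal (E x ω ^ 2) ∂P ≤
      ENNReal.ofReal (5 * (1 / n) ^ (2 * H + 1)) := by
    filter_upwards [ae_mem_Ioo_volD, Measure.ae_ae_of_ae_prod hue,
      Measure.ae_ae_of_ae_prod hve] with x hx h1 h2
    have hx' := Ioo_subset_Icc_self hx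
    obtain ⟨X, hX, hXu⟩ := hu.mild x hx
    refine le_trans (le_of_eq (lintegral_congr_ae ?_))
      (hX.lintegral_sq_sub_le hH0 hH hW hx' hn)
    filter_upwards [h1, h2, hgreen, hXu, hunI, hu.memLp] with ω h1 h2 h3 h4 h5 h6
    have h7 := h5.2 x hx
    have hi1 := integrable_green_mul ((hf.memLp_comp h6).integrable (by norm_num)) hx'
    have hi2 := integrable_green_mul ((hf.memLp_comp h5.1).integrable (by norm_num)) hx'
    have h8 : greenOp (fun y => f y (u y ω) - f y (un y ω)) x =
        ∫ y, green x y * f y (u y ω) ∂volD - greenOp (fun y => f y (un y ω)) x := by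
      simp only [greenOp, mul_sub]
      exact integral_sub hi1 hi2
    congr 2
    simp only [hE]
    rw [h3, h8, ← h1, ← h2]
    linarith
  have hpath : ∀ᵐ ω ∂P, eLpNorm (fun x => u x ω - un x ω) 2 volD ^ 2 ≤
      ENNReal.ofReal (2 * (1 + 2 * a / κ)) * ∫⁻ x, ENNReal.ofReal (E x ω ^ 2) ∂volD +
        ENNReal.ofReal (4 * b / κ) := by
    filter_upwards [ae_ae_swap hue, ae_ae_swap hve, hgreen, hu.memLp, hunI] with ω h1 h2 h3 h4 h5
    have he : MemLp (fun x => u x ω - un x ω) 2 volD := h4.sub h5.1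
    have hF : MemLp (fun x => f x (u x ω) - f x (un x ω)) 2 volD :=
      (hf.memLp_comp h4).sub (hf.memLp_comp h5.1)
    obtain ⟨hEL, hle⟩ := integral_sq_le_of_energy (a := a) (b := b) hκ hP hF he (by
      filter_upwards [ae_mem_Ioo_volD] with x hx using hpt x hx _ _ _)
    have hEe : ∫⁻ x, ENNReal.ofReal (E x ω ^ 2) ∂volD =
        ∫⁻ x, ENNReal.ofReal ((u x ω - un x ω +
          greenOp (fun x => f x (u x ω) - f x (un x ω)) x) ^ 2) ∂volD := by
      refine lintegral_congr_ae ?_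
      filter_upwards [h1, h2] with x h1 h2
      simp only [hE]
      rw [h3, ← h1, ← h2]
    rw [eLpNorm_two_sq, lintegral_ofReal_sq_eq he, hEe, lintegral_ofReal_sq_eq hEL,
      ← ENNReal.ofReal_mul (by positivity), ← ENNReal.ofReal_add
        (mul_nonneg (by positivity) (integral_nonneg fun x => sq_nonneg _)) (by positivity)]
    exact ENNReal.ofReal_le_ofReal hle
  unfold msError
  refine ENNReal.rpow_le_rpow ?_ (by norm_num)
  have hEm2 : Measurable fun p : Ω × ℝ => ENNReal.ofReal (E p.2 p.1 ^ 2) :=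
    ((hEm.comp measurable_swap).pow_const 2).ennreal_ofReal
  calc _ ≤ ∫⁻ ω, (ENNReal.ofReal (2 * (1 + 2 * a / κ)) *
        ∫⁻ x, ENNReal.ofReal (E x ω ^ 2) ∂volD + ENNReal.ofReal (4 * b / κ)) ∂P :=
        lintegral_mono_ae hpath
    _ = ENNReal.ofReal (2 * (1 + 2 * a / κ)) *
        (∫⁻ x, ∫⁻ ω, ENNReal.ofReal (E x ω ^ 2) ∂P ∂volD) + ENNReal.ofReal (4 * b / κ) := by
        rw [lintegral_add_right _ measurable_const, lintegral_const, measure_univ, mul_one,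
          lintegral_const_mul _ hEm2.lintegral_prod_right', lintegral_lintegral_swap
          hEm2.aemeasurable]
    _ ≤ ENNReal.ofReal (2 * (1 + 2 * a / κ)) *
        ENNReal.ofReal (5 * (1 / n) ^ (2 * H + 1)) + ENNReal.ofReal (4 * b / κ) := by
        gcongr
        refine (lintegral_mono_ae hmean).trans (le_of_eq (lintegral_volD_const _))
    _ = _ := by
        rw [← ENNReal.ofReal_mul (by positivity), ← ENNReal.ofReal_add (by positivity)
          (by positivity)]

end Stochastic

/-! ### Convergence rates -/

lemma ofReal_rpow_half_le {K h r : ℝ} (hK : 0 ≤ K) (hh : 0 ≤ h) {y : ℝ} (hy : y ≤ K * h ^ r) :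
    ENNReal.ofReal y ^ (1 / 2 : ℝ) ≤ ENNReal.ofReal ((Real.sqrt K + 1) * h ^ (r / 2)) := by
  have hr : 0 ≤ h ^ r := Real.rpow_nonneg hh r
  have hr' : 0 ≤ h ^ (r / 2) := Real.rpow_nonneg hh _
  calc _ ≤ ENNReal.ofReal (K * h ^ r) ^ (1 / 2 : ℝ) :=
        ENNReal.rpow_le_rpow (ENNReal.ofReal_le_ofReal hy) (by norm_num)
    _ = ENNReal.ofReal (Real.sqrt K * h ^ (r / 2)) := by
        rw [ENNReal.ofReal_rpow_of_nonneg (by positivity) (by norm_num),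
          Real.mul_rpow hK hr, ← Real.sqrt_eq_rpow, ← Real.rpow_mul hh]
        congr 3
        ring
    _ ≤ _ := ENNReal.ofReal_le_ofReal (by nlinarith)

end FracBVP

theorem mainTheorem2 {Ω : Type*} [MeasurableSpace Ω] (P : Measure Ω) [IsProbabilityMeasure P]
    (H : ℝ) (hH0 : 0 < H) (hH : H ≤ 1 / 2)
    (W : ℝ → Ω → ℝ) (hW : FracBVP.IsFBM P H W)
    (L β : ℝ) (f : ℝ → ℝ → ℝ) (hf : FracBVP.IsAdmissible L β f)
    (g : ℝ → ℝ) (hg : MemLp g 2 FracBVP.volD) :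
    (∃ C : ℝ, 0 < C ∧ ∀ u : ℝ → Ω → ℝ, FracBVP.IsMildSolution P W f g u →
      ∀ n : ℕ, 1 ≤ n → ∀ un : ℝ → Ω → ℝ, FracBVP.IsApproxSolution P W f g n un →
        FracBVP.msError P u un ≤ ENNReal.ofReal (C * (1 / (n : ℝ)) ^ (H / 2 + 1 / 4))) ∧
    ((∀ x ∈ Ioo (0 : ℝ) 1, ∀ r s : ℝ, |f x r - f x s| ≤ L * |r - s|) →
      ∃ C : ℝ, 0 < C ∧ ∀ u : ℝ → Ω → ℝ, FracBVP.IsMildSolution P W f g u →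
        ∀ n : ℕ, 1 ≤ n → ∀ un : ℝ → Ω → ℝ, FracBVP.IsApproxSolution P W f g n un →
          FracBVP.msError P u un ≤ ENNReal.ofReal (C * (1 / (n : ℝ)) ^ (H + 1 / 2))) := by
  obtain ⟨c, hLc, hc⟩ := FracBVP.exists_poincare hf.L_lt
  -- `κ` is the gap between `L` and an admissible Poincaré constant strictly above it.
  obtain ⟨κ, hκ, rfl⟩ : ∃ κ, 0 < κ ∧ c = L + κ := ⟨c - L, by linarith, by ring⟩
  have hL := hf.L_pos
  have hβ := hf.β_pos
  constructor
  · set M := β ^ 2 / κ + β + 4 * L ^ 2 / κ + L with hM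
    have hM0 : 0 < M := by positivity
    set K := 10 * (1 + 2 * (β + M) / κ) + 4 * β / κ with hK
    have hK0 : 0 < K := by positivity
    refine ⟨Real.sqrt K + 1, by positivity, fun u hu n hn un hun => ?_⟩
    have hn' : (1 : ℝ) ≤ n := by exact_mod_cast hn
    have hh0 : (0 : ℝ) < 1 / n := by positivity
    have hh1 : 1 / (n : ℝ) ≤ 1 := by rw [div_le_one (by linarith)]; exact hn'
    -- The mean square of the noise error is at most `5 δ²`, so `(β/δ) · δ²` and the constant term
    -- `β δ` are of the same order `δ`.
    set δ := (1 / (n : ℝ)) ^ (H + 1 / 2) with hδ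
    have hδ0 : 0 < δ := by positivity
    have hδ1 : δ ≤ 1 := Real.rpow_le_one hh0.le hh1 (by linarith)
    refine (FracBVP.msError_le_of_pointwise hH0 hH hW hf hg hκ (a := β / δ + M) (b := β * δ)
      (by positivity) (by positivity) hc
      (fun x hx r s v => hf.mul_le hκ hδ0 hx r s v) hu hn hun).trans ?_
    rw [show H / 2 + 1 / 4 = (H + 1 / 2) / 2 by ring]
    refine FracBVP.ofReal_rpow_half_le hK0.le hh0.le ?_
    have hsq : (1 / (n : ℝ)) ^ (2 * H + 1) = δ ^ 2 := by
      rw [hδ, ← Real.rpow_natCast, ← Real.rpow_mul hh0.le]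
      congr 1
      push_cast
      ring
    rw [hsq, ← hδ]
    have e : 2 * (1 + 2 * (β / δ + M) / κ) * (5 * δ ^ 2) + 4 * (β * δ) / κ =
        (10 * (δ + 2 * (β + M * δ) / κ) + 4 * β / κ) * δ := by
      field_simp
      ring
    rw [e, hK]
    have : M * δ ≤ M := mul_le_of_le_one_right hM0.le hδ1
    gcongr
  · intro hLip
    set K := 2 * (1 + 2 * (L ^ 2 / (2 * κ)) / κ) * 5 with hK
    have hK0 : 0 < K := by positivity
    refine ⟨Real.sqrt K + 1, by positivity, fun u hu n hn un hun => ?_⟩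
    have hn' : (1 : ℝ) ≤ n := by exact_mod_cast hn
    -- With `b = 0` and `a` independent of `n`, the mean-square error inherits the full order
    -- `h^(2H+1)` of the noise before the square root.
    refine (FracBVP.msError_le_of_pointwise hH0 hH hW hf hg hκ (a := L ^ 2 / (2 * κ)) (b := 0)
      (by positivity) le_rfl hc
      (fun x hx r s v => FracBVP.mul_le_of_lipschitz hL hκ (hLip x hx r s) v) hu hn hun).trans ?_
    rw [show H + 1 / 2 = (2 * H + 1) / 2 by ring]
    refine FracBVP.ofReal_rpow_half_le hK0.le (by positivity) (le_of_eq ?_)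
    rw [hK]
    ring
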